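/- \textbf{Conventions.} Everything is formal: "series" are formal series $\sum_q c_q\nu^q$ with rational exponents, and infinite sums are taken coefficientwise. For $f(x)=\sum_{k\ge\kappa}f_kx^k$ analytic at $0$ with $\kappa\ge1$, $f_\kappa\ne0$, put $f^{\Uparrow}(n,\tau)=\sum_{k\ge\kappa}f_k\,n^{-k}\,\frac{B_{k+1}(\tau+\frac12)}{k+1}$ ($B_m$ the Bernoulli polynomials). The nir-transform of $f$ is $$\frac1{2\pi i}\int_{c-i\infty}^{c+i\infty}e^{n\nu}\frac{dn}{n}\int_0^\infty \exp^{\#}\!\big(-f^{\Uparrow}(n,\tau)\big)\,d\tau ,$$ where $\exp^{\#}$ means that $\exp\big(-f_\kappa n^{-\kappa}\tau^{\kappa+1}/(\kappa+1)\big)$ is kept and the exponential of the rest is expanded as a power series; one then integrates term by term, using $\int_0^\infty e^{-f_\kappa n^{-\kappa}\tau^{\kappa+1}/(\kappa+1)}\tau^p\,d\tau=f_\kappa^{-\frac{p+1}{\kappa+1}}(\kappa+1)^{\frac{p+1}{\kappa+1}-1}\Gamma\big(\tfrac{p+1}{\kappa+1}\big)\,n^{\frac{\kappa(p+1)}{\kappa+1}}$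 and $\frac1{2\pi i}\int e^{n\nu}n^{-q}\frac{dn}{n}=\frac{\nu^q}{\Gamma(q+1)}$. For $\alpha\in\mathbb C\setminus\{0\}$ let $f_\alpha(x)=\alpha\log(1+\alpha x)$; here $\kappa=1$, $f_1=\alpha^2$, and the determination $(\alpha^2)^{1/2}=\alpha$ is used (the main one for $\operatorname{Re}\alpha>0$). Let $h_\alpha(\nu)$ be the singular part of the nir-transform of $f_\alpha$, i.e. the part carried by the non-integer powers of $\nu$. Define polynomials $T_{2k}\in\mathbb Q[\beta]$ by $\sum_{k\ge0}T_{2k}(\beta)\frac{x^{2k}}{(2k)!}=\Big(\frac{\sinh(x/2)}{x/2}\Big)^{\beta}$ and $S_k\in\mathbb Q[D,\beta]$ by $$S_k(D,\beta)=\Big(\prod_{i=1}^k(\beta+i)\Big)\sum_{k_1+2k_2=k}\frac{D^{k_1}}{k_1!}\,\frac{T_{2k_2}(\beta)}{(2k_2)!}.$$ \textbf{Proposition.} (1) For all $a\in\mathbb N$ and all elements $d,D$ of an associative unital $\mathbb C$-algebra with $dD-Dd=d$, one has $(d+D)^a=\sum_{k=0}^{a}S_k\big(D+\tfrac{a-k}2,\,a-k\big)\,d^{\,a-k}$.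 (2) For every $\alpha\ne0$, $h_\alpha=-h_{-\alpha}$ (and the same holds for the whole nir-transform of $f_\alpha$). There are polynomials $\gamma_{-\frac12+n}\in\mathbb Q[X]$ ($n\in\mathbb N$), of degree exactly $n$, with $\gamma_{-\frac12}=1$, such that for every $\alpha\ne0$ $$h_\alpha(\nu)=\frac1{\sqrt2\,\alpha}\sum_{n\ge0}\gamma_{-\frac12+n}(\alpha^2)\,\nu^{-\frac12+n}.$$ (3) For every $\alpha\neq0$, $h_\alpha$ satisfies the infinite integro-differential equation $$\sum_{k\ge1}\partial_\nu^{-k}\,S_k\big(\nu\partial_\nu+\tfrac k2,\ \alpha-k\big)\,h_\alpha(-\nu)=0,$$ where $\partial_\nu^{-1}$ is integration from $\nu=0$, i.e. $\nu^q\mapsto\nu^{q+1}/(q+1)$, $(-\nu)^q=e^{i\pi q}\nu^q$, and $S_k(\nu\partial_\nu+\frac k2,\alpha-k)$ multiplies each monomial $\nu^q$ by the scalar $S_k(q+\frac k2,\alpha-k)$. (4) Consequently, for every $\alpha\ne0$ and $n\ge1$, $$\gamma_{-\frac12+n}(\alpha^2)=\sum_{k=1}^{n}(-1)^{k+1}\,\frac{\Gamma(\frac12+n-k)}{\Gamma(\frac12+n)}\;\frac{S_{k+1}(n-\frac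 k2,\ \alpha-k-1)}{n\,\alpha}\;\gamma_{-\frac12+n-k}(\alpha^2).$$ -/

import Mathlib

open scoped Polynomial

namespace Nir

/-! ### Formal ramified series in `ν` -/

/-- Formal series `∑ c q • ν ^ q` with rational exponents, given by the coefficient function `c`.
Infinite sums of such series are taken coefficientwise (product topology). -/
abbrev Ser : Type := ℚ → ℂ

/-- The monomial `ν ^ q`. -/
noncomputable def mono (q : ℚ) : Ser := Pi.single q 1

/-- The part of a series carried by the non-integer (ramified) powers of `ν`. -/
noncomputable def singularPart (h : Ser) : Ser := fun q => if q.den = 1 then 0 else h q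

/-- `h(ν) ↦ h(-ν)`, with `(-ν) ^ q = (-1) ^ q ν ^ q` and `(-1) ^ q = exp (iπq)`. -/
noncomputable def reflect (h : Ser) : Ser := fun q => (-1 : ℂ) ^ (q : ℂ) * h q

/-- The Euler operator `ν ∂_ν`, i.e. `ν ^ q ↦ q ν ^ q`. -/
noncomputable def euler : Module.End ℂ Ser where
  toFun h := fun q => (q : ℂ) * h q
  map_add' a b := by funext q; simp [mul_add]
  map_smul' c a := by funext q; simp [mul_left_comm]

/-- Integration `∂_ν⁻¹` from `ν = 0`, i.e. `ν ^ q ↦ ν ^ (q + 1) / (q + 1)`.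
It is only used on series whose exponents are `> -1`. -/
noncomputable def integ : Module.End ℂ Ser where
  toFun h := fun q => h (q - 1) / (q : ℂ)
  map_add' a b := by funext q; simp [add_div]
  map_smul' c a := by funext q; simp [mul_div_assoc]

/-! ### The nir-transform (standard choice of `β`) -/

/-- The Taylor coefficient `f_k` of `f` at `0`. -/
noncomputable def taylorCoeff (f : ℂ → ℂ) (k : ℕ) : ℂ := iteratedDeriv k f 0 / (k.factorial : ℂ)

/-- The tangency order `κ` of `f`: the index of the first nonzero Taylor coefficient. -/
noncomputable def tangency (f : ℂ → ℂ) : ℕ := sInf {k : ℕ | taylorCoeff f k ≠ 0}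

/-- `β*_k(τ) = B_{k+1}(τ + 1/2) / (k + 1)`, as a polynomial in `τ`. -/
noncomputable def betaStar (k : ℕ) : ℂ[X] :=
  Polynomial.C (1 / ((k : ℂ) + 1)) *
    ((Polynomial.bernoulli (k + 1)).map (algebraMap ℚ ℂ)).comp
      (Polynomial.X + Polynomial.C (1 / 2))

/-- `∑_{k ≥ κ} f_k n^{-k} β*_k(τ) - f_κ n^{-κ} τ^{κ+1} / (κ+1)`, as a power series in `n⁻¹` with
coefficients polynomial in `τ`. -/
noncomputable def perturbation (f : ℂ → ℂ) : PowerSeries ℂ[X] :=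
  PowerSeries.mk fun k =>
    Polynomial.C (taylorCoeff f k) * betaStar k -
      if k = tangency f then
        Polynomial.C (taylorCoeff f k / ((k : ℂ) + 1)) * Polynomial.X ^ (k + 1)
      else 0

/-- The coefficient of `n^{-N}` (a polynomial in `τ`) in `exp (-g)`, expanded as a power series,
for `g` a power series in `n⁻¹` without constant term (so that `g ^ s` only contributes to
`n^{-N}` when `s ≤ N`). -/
noncomputable def expNegCoeff (g : PowerSeries ℂ[X]) (N : ℕ) : ℂ[X] :=
  ∑ s ∈ Finset.range (N + 1),
    Polynomial.C (1 / (s.factorial : ℂ)) * PowerSeries.coeff N ((-g) ^ s)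

/-- The scalar factor in the ramified Laplace integral
`∫_0^∞ exp (-f_κ n^{-κ} τ^{κ+1} / (κ+1)) τ^p dτ = laplaceFactor κ ρ p * n ^ (κ (p+1) / (κ+1))`,
where `ρ` is the chosen determination of `f_κ ^ (1/(κ+1))`. -/
noncomputable def laplaceFactor (κ : ℕ) (ρ : ℂ) (p : ℕ) : ℂ :=
  (ρ ^ (p + 1))⁻¹ * ((κ : ℂ) + 1) ^ (((p : ℂ) + 1) / ((κ : ℂ) + 1) - 1) *
    Complex.Gamma (((p : ℂ) + 1) / ((κ : ℂ) + 1))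

/-- The nir-transform of `f`, for the determination `ρ` of `f_κ ^ (1/(κ+1))`: the monomials
`n^{-N} τ^p` of `exp_# (-f^↑)` are Laplace-integrated in `τ`, and the resulting powers of `n` are
turned by the upper Borel transform `n^{-q} ↦ ν^q / Γ(q+1)` into powers of `ν`, where
`q = N - κ (p+1) / (κ+1)`. Only finitely many `(N, p)` contribute to each `ν^q`. -/
noncomputable def nir (f : ℂ → ℂ) (ρ : ℂ) : Ser := fun q =>
  ∑ᶠ x : ℕ × ℕ,
    if (x.1 : ℚ) - (tangency f : ℚ) * ((x.2 : ℚ) + 1) / ((tangency f : ℚ) + 1) = q then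
      (expNegCoeff (perturbation f) x.1).coeff x.2 * laplaceFactor (tangency f) ρ x.2 /
        Complex.Gamma ((q : ℂ) + 1)
    else 0

/-- The nir-transform of `f` for the main determination of `f_κ ^ (1/(κ+1))`. -/
noncomputable def nirMain (f : ℂ → ℂ) : Ser :=
  nir f (taylorCoeff f (tangency f) ^ (1 / ((tangency f : ℂ) + 1)))

/-- `f_α(x) = α log (1 + α x)`. -/
noncomputable def fLog (α : ℂ) : ℂ → ℂ := fun x => α * Complex.log (1 + α * x)

/-- The nir-transform of `f_α`. Here `κ = 1` and `f_κ = α ^ 2`, and the determination of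
`(α ^ 2) ^ (1/2)` is `α` (the main one for `Re α > 0`, continued analytically in `α`). -/
noncomputable def hFull (α : ℂ) : Ser := nir (fLog α) α

/-- The series `h_α`: the singular part of the nir-transform of `f_α`. -/
noncomputable def h (α : ℂ) : Ser := singularPart (hFull α)

/-! ### The polynomials `T_{2k}(β)` and `S_k(D, β)` -/

/-- The power series `sinh (x/2) / (x/2) = ∑_j x^{2j} / (4^j (2j+1)!)`. -/
noncomputable def sinhc : PowerSeries ℚ :=
  PowerSeries.mk fun n => if Even n then 1 / (2 ^ n * ((n + 1).factorial : ℚ)) else 0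

/-- `T k` is `T_{2k}(β) ∈ ℚ[β]`, defined by
`∑_k T_{2k}(β) x^{2k} / (2k)! = (sinh (x/2) / (x/2)) ^ β = ∑_j (β choose j) (sinhc - 1) ^ j`;
only the `j ≤ k` contribute to `x^{2k}`. -/
noncomputable def T (k : ℕ) : ℚ[X] :=
  Polynomial.C ((2 * k).factorial : ℚ) *
    ∑ j ∈ Finset.range (k + 1),
      Polynomial.C (PowerSeries.coeff (2 * k) ((sinhc - 1) ^ j) / (j.factorial : ℚ)) *
        descPochhammer ℚ j

/-- `S_k(D, β) = (∏_{i=1}^k (β + i)) ∑_{k₁ + 2 k₂ = k} (D^{k₁} / k₁!) (T_{2k₂}(β) / (2k₂)!)`,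
as a polynomial in `D` (outer variable) over `ℚ[β]`. -/
noncomputable def S (k : ℕ) : ℚ[X][X] :=
  Polynomial.C (∏ i ∈ Finset.Icc 1 k, (Polynomial.X + Polynomial.C (i : ℚ))) *
    ∑ j ∈ Finset.range (k / 2 + 1),
      Polynomial.C
          (Polynomial.C (1 / (((k - 2 * j).factorial : ℚ) * ((2 * j).factorial : ℚ))) * T j) *
        Polynomial.X ^ (k - 2 * j)

/-- The value `S_k(D, β)` for a scalar `β` and an element `D` (a scalar or an operator) of a
complex algebra. -/
noncomputable def evalS {A : Type*} [Ring A] [Algebra ℂ A] (k : ℕ) (D : A) (β : ℂ) : A :=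
  Polynomial.aeval D ((S k).map (Polynomial.aeval β : ℚ[X] →ₐ[ℚ] ℂ).toRingHom)

end Nir

namespace Nir

/-! ### The polynomials `S_k(D, b)` for `b ∈ ℕ` and the expansion of `(d + D) ^ a` -/

/-! Write `t = n⁻¹`. A term `t^N τ^p` of the exponential contributes to the power `ν^(N - (p+1)/2)`,
so odd `p` gives integer exponents and even `p` half-integer ones. The singular part therefore only
sees even powers of `τ`: up to a factor `2` it is a Gaussian integral over the whole line, and such
an integral is invariant under translations of `τ` and has no boundary terms (`gaussInt_shiftExp`,
`gaussInt_integration_by_parts`).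

Put `u = 1 + α(τ - 1/2)t` and `E(τ) = exp(-f_α^↑(n,τ))`. The difference equation of the Bernoulli
polynomials gives `u^α E(τ) = E(τ-1)` (`binomSer_mul_shiftExp`), so by translation invariance `∫ u^α
E = ∫ E`. On the other hand `(1 + αx) f_α' = α²` gives a first-order equation for `E`, from which `∫
u^(j+1) E = ∫ u^j E + t (j - α/2 - t∂_t) ∫ u^j E` (`stepMoment_succ_succ`). Hence, for natural `a`,
`(-n)^a ∫ u^a E = (d + D)^a ∫ E` with `d = -n`, `D = t∂_t + α/2` and `[d, D] = d`. The expansion of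
`(d + D)^a` (`add_pow_of_commutator`) expresses `∫ u^a E` through `∫ E` by the polynomials `S_k`.
Each coefficient is polynomial in `a`, so the formula extends from natural `a` to the complex value
`a = α`; comparison with `∫ u^α E = ∫ E` cancels the term `k = 0` and leaves a relation between the
coefficients of `∫ E` (`sum_evalS_mul_stepMoment`).

The Borel transform turns this relation into the integro-differential equation; its term `k = 1`,
which is `-nα` times a coefficient, yields the recursion. Polynomiality and the degree follow from
the recursion, since `S_{k+1}` contains the factor `α` that is divided out. Parity in `α` comes from
the symmetry `(α, τ) ↦ (-α, -τ)`. -/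

/-- `sinh (x/2) / (x/2)` as a power series over `ℂ[X]`. -/
noncomputable def sinhSer : PowerSeries ℂ[X] := sinhc.map (algebraMap ℚ ℂ[X])

/-- `exp (p x)` as a power series in `x`. -/
noncomputable def expSer (p : ℂ[X]) : PowerSeries ℂ[X] :=
  PowerSeries.rescale p (PowerSeries.exp ℂ[X])

/-- The coefficient of `x ^ k` in `exp (X x) (sinh (x/2) / (x/2)) ^ b`. -/
noncomputable def sinhCoeff (k b : ℕ) : ℂ[X] :=
  PowerSeries.coeff k (expSer Polynomial.X * sinhSer ^ b)

/-- The polynomial `S_k(X, b)` for a natural number `b`. -/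
noncomputable def SNat (k b : ℕ) : ℂ[X] :=
  (∏ i ∈ Finset.Icc 1 k, ((b : ℂ[X]) + (i : ℂ[X]))) * sinhCoeff k b

theorem derivative_expSer (p : ℂ[X]) :
    PowerSeries.derivative ℂ[X] (expSer p) = PowerSeries.C p * expSer p := by
  ext1 n
  rw [PowerSeries.coeff_derivative, PowerSeries.coeff_C_mul]
  simp only [expSer, PowerSeries.coeff_rescale, PowerSeries.coeff_exp]
  have h1 : (algebraMap ℚ ℂ[X]) (1 / ((n + 1).factorial : ℚ)) * ((n : ℂ[X]) + 1)
      = algebraMap ℚ ℂ[X] (1 / (n.factorial : ℚ)) := by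
    have : ((n : ℂ[X]) + 1) = algebraMap ℚ ℂ[X] ((n : ℚ) + 1) := by simp
    rw [this, ← map_mul]
    congr 1
    rw [Nat.factorial_succ]
    push_cast
    field_simp
  rw [mul_assoc, h1]
  ring

theorem expSer_add (p q : ℂ[X]) : expSer (p + q) = expSer p * expSer q :=
  (PowerSeries.exp_mul_exp_eq_exp_add p q).symm

theorem coeff_zero_expSer (p : ℂ[X]) : PowerSeries.coeff 0 (expSer p) = 1 := by
  rw [expSer, PowerSeries.coeff_rescale, PowerSeries.coeff_exp]
  simp

theorem coeff_zero_sinhSer : PowerSeries.coeff 0 sinhSer = 1 := by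
  rw [sinhSer, PowerSeries.coeff_map, sinhc, PowerSeries.coeff_mk]
  simp

/-- For `s = sinh(x/2)/(x/2)`, `(x s)' = cosh(x/2)` and `(x/2) s = sinh(x/2)`. The resulting single
exponential is what produces the shift of the variable by `1/2` in the recurrence for `S_k`. -/
theorem sinhSer_ode :
    sinhSer + PowerSeries.X * PowerSeries.derivative ℂ[X] sinhSer
      + PowerSeries.X * (PowerSeries.C (Polynomial.C (1 / 2)) * sinhSer)
      = expSer (Polynomial.C (1 / 2)) := by
  have half : (Polynomial.C (1 / 2) : ℂ[X]) = algebraMap ℚ ℂ[X] (1 / 2) := by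
    rw [IsScalarTower.algebraMap_apply ℚ ℂ ℂ[X]]
    simp
  rw [half]
  ext1 n
  cases n with
  | zero =>
    simp [coeff_zero_sinhSer, coeff_zero_expSer, PowerSeries.coeff_zero_X_mul,
      -PowerSeries.coeff_zero_eq_constantCoeff]
  | succ n =>
    simp only [map_add, PowerSeries.coeff_succ_X_mul, PowerSeries.coeff_C_mul,
      PowerSeries.coeff_derivative, expSer, PowerSeries.coeff_rescale, PowerSeries.coeff_exp,
      sinhSer, PowerSeries.coeff_map, sinhc, PowerSeries.coeff_mk]
    have : ((n : ℂ[X]) + 1) = algebraMap ℚ ℂ[X] ((n : ℚ) + 1) := by simp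
    rw [this]
    simp only [← map_mul, ← map_pow, ← map_add]
    congr 1
    -- `s + x s'` is even and `(x/2) s` is odd, so each coefficient of the exponential comes from
    -- only one of them.
    rcases Nat.even_or_odd n with hn | hn
    · have h2 : ¬ Even (n + 1) := by
        rw [Nat.not_even_iff_odd]; exact hn.add_one
      simp only [hn, h2, if_true, if_false, one_div, inv_pow]
      field_simp
      ring
    · have h2 : Even (n + 1) := hn.add_one
      have h3 : ¬ Even n := Nat.not_even_iff_odd.mpr hn
      simp only [h3, h2, if_true, if_false, one_div, inv_pow]
      rw [Nat.factorial_succ (n + 1)]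
      push_cast
      field_simp
      ring

theorem sinhCoeff_zero (k : ℕ) : sinhCoeff k 0 =
    Polynomial.X ^ k * algebraMap ℚ ℂ[X] (1 / (k.factorial : ℚ)) := by
  simp [sinhCoeff, expSer, PowerSeries.coeff_rescale, PowerSeries.coeff_exp]

theorem expSer_comp (p q : ℂ[X]) :
    (expSer p).map (Polynomial.compRingHom q) = expSer (p.comp q) := by
  ext1 n
  simp [expSer, PowerSeries.coeff_rescale, PowerSeries.coeff_exp]

theorem sinhSer_comp (q : ℂ[X]) :
    sinhSer.map (Polynomial.compRingHom q) = sinhSer := by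
  ext1 n
  simp only [sinhSer, PowerSeries.coeff_map, IsScalarTower.algebraMap_apply ℚ ℂ ℂ[X]]
  simp

theorem sinhCoeff_comp (k b : ℕ) (q : ℂ[X]) :
    (sinhCoeff k b).comp q = PowerSeries.coeff k (expSer q * sinhSer ^ b) := by
  have := PowerSeries.coeff_map (Polynomial.compRingHom q) k (expSer Polynomial.X * sinhSer ^ b)
  rw [map_mul, map_pow, expSer_comp, sinhSer_comp, Polynomial.X_comp] at this
  rw [this]
  rfl

theorem derivative_mul_pow_succ {B : Type*} [CommRing B] (e s : PowerSeries B) (b : ℕ) :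
    PowerSeries.derivative B (e * s ^ (b + 1)) = PowerSeries.derivative B e * s ^ (b + 1) +
      ((b : PowerSeries B) + 1) * (e * s ^ b * PowerSeries.derivative B s) := by
  rw [Derivation.leibniz, Derivation.leibniz_pow]
  simp only [smul_eq_mul, nsmul_eq_mul, Nat.add_sub_cancel]
  push_cast
  ring

/-- Apply `b + 1 + x∂_x` to `e^{Xx} s^{b+1}` and eliminate `x s'` with `sinhSer_ode`. The factor on
the left is the last factor of the product in `SNat (k + 1) (b + 1)`. -/
theorem sinhCoeff_succ_succ (k b : ℕ) :
    ((b : ℂ[X]) + 1 + ((k : ℂ[X]) + 1)) * sinhCoeff (k + 1) (b + 1) =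
      ((b : ℂ[X]) + 1) * (sinhCoeff (k + 1) b).comp (Polynomial.X + Polynomial.C (1 / 2)) +
        (Polynomial.X - ((b : ℂ[X]) + 1) * Polynomial.C (1 / 2)) * sinhCoeff k (b + 1) := by
  set e := expSer Polynomial.X
  set s := sinhSer
  have key : PowerSeries.C ((b : ℂ[X]) + 1) * (e * s ^ (b + 1)) +
      PowerSeries.X * PowerSeries.derivative ℂ[X] (e * s ^ (b + 1)) =
      PowerSeries.C ((b : ℂ[X]) + 1) *
        (expSer (Polynomial.X + Polynomial.C (1 / 2)) * s ^ b) +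
      PowerSeries.X * (PowerSeries.C
        (Polynomial.X - ((b : ℂ[X]) + 1) * Polynomial.C (1 / 2)) * (e * s ^ (b + 1))) := by
    rw [expSer_add, ← sinhSer_ode, derivative_mul_pow_succ, derivative_expSer]
    simp only [map_sub, map_add, map_mul, map_natCast, map_one]
    ring
  have := congrArg (PowerSeries.coeff (k + 1)) key
  simp only [map_add (PowerSeries.coeff (k + 1)), PowerSeries.coeff_succ_X_mul,
    PowerSeries.coeff_C_mul, PowerSeries.coeff_derivative] at this
  rw [sinhCoeff_comp]
  simp only [sinhCoeff]
  linear_combination this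

theorem SNat_zero (b : ℕ) : SNat 0 b = 1 := by
  have h1 : PowerSeries.coeff 0 (sinhSer ^ b) = 1 := by
    rw [PowerSeries.coeff_zero_eq_constantCoeff_apply, map_pow,
      ← PowerSeries.coeff_zero_eq_constantCoeff_apply, coeff_zero_sinhSer, one_pow]
  simp [SNat, sinhCoeff, PowerSeries.coeff_mul, h1, coeff_zero_expSer,
    -PowerSeries.coeff_zero_eq_constantCoeff]

theorem SNat_succ_zero (k : ℕ) : SNat (k + 1) 0 = Polynomial.X * SNat k 0 := by
  simp only [SNat, sinhCoeff_zero, Finset.prod_Icc_succ_top (Nat.le_add_left 1 k)]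
  have : algebraMap ℚ ℂ[X] (1 / (k.factorial : ℚ)) =
      ((k + 1 : ℕ) : ℂ[X]) * algebraMap ℚ ℂ[X] (1 / ((k + 1).factorial : ℚ)) := by
    rw [← map_natCast (algebraMap ℚ ℂ[X]), ← map_mul]
    congr 1
    rw [Nat.factorial_succ]
    push_cast
    field_simp
  rw [this]
  push_cast
  ring

theorem SNat_succ_succ (k b : ℕ) : SNat (k + 1) (b + 1) =
    (SNat (k + 1) b).comp (Polynomial.X + Polynomial.C (1 / 2)) +
      (Polynomial.X - ((b : ℂ[X]) + 1) * Polynomial.C (1 / 2)) * SNat k (b + 1) := by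
  have h1 : ∏ i ∈ Finset.Icc 1 (k + 1), ((b : ℂ[X]) + (i : ℂ[X])) =
      ((b : ℂ[X]) + 1) * ∏ i ∈ Finset.Icc 1 k, (((b + 1 : ℕ) : ℂ[X]) + (i : ℂ[X])) := by
    rw [← Finset.mul_prod_Ioc_eq_prod_Icc (Nat.le_add_left 1 k)]
    congr 1
    · simp
    · rw [show Finset.Ioc 1 (k + 1) = (Finset.Icc 1 k).map (addRightEmbedding 1) by
        rw [Finset.map_add_right_Icc]; ext; simp [Finset.mem_Ioc, Finset.mem_Icc]; omega]
      rw [Finset.prod_map]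
      refine Finset.prod_congr rfl fun i _ => ?_
      simp
      ring
  have h2 := sinhCoeff_succ_succ k b
  simp only [SNat, Polynomial.mul_comp, Polynomial.prod_comp]
  rw [Finset.prod_Icc_succ_top (Nat.le_add_left 1 k)]
  have h3 : ∏ i ∈ Finset.Icc 1 (k + 1), ((b : ℂ[X]) + (i : ℂ[X])).comp
      (Polynomial.X + Polynomial.C (1 / 2)) =
      ∏ i ∈ Finset.Icc 1 (k + 1), ((b : ℂ[X]) + (i : ℂ[X])) := by
    refine Finset.prod_congr rfl fun i _ => ?_
    simp
  rw [h3, h1]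
  push_cast at h2 ⊢
  linear_combination (∏ i ∈ Finset.Icc 1 k, ((b : ℂ[X]) + 1 + (i : ℂ[X]))) * h2

section

variable {A : Type*} [Ring A] [Algebra ℂ A]

theorem mul_aeval_of_commutator {d D : A} (hd : d * D - D * d = d) (p : ℂ[X]) :
    d * Polynomial.aeval D p = Polynomial.aeval (D + 1) p * d := by
  have h1 : d * D = (D + 1) * d := by
    rw [add_mul, one_mul]
    exact (sub_eq_iff_eq_add'.mp hd)
  have h2 : SemiconjBy d D (D + 1) := h1
  induction p using Polynomial.induction_on' with
  | add p q hp hq => simp [mul_add, add_mul, hp, hq]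
  | monomial n c =>
    simp only [Polynomial.aeval_monomial]
    rw [← mul_assoc, ← Algebra.commutes, mul_assoc, (h2.pow_right n).eq, mul_assoc]

/-- Multiply on the left by `d + D`. Moving `d` to the right turns `D + b/2` into `D + (b+1)/2 +
1/2`, and the other summand is `D = (D + (b+1)/2) - (b+1)/2`: these are the two terms of
`SNat_succ_succ`. -/
theorem add_pow_of_commutator {d D : A} (hd : d * D - D * d = d) (a : ℕ) :
    (d + D) ^ a = ∑ k ∈ Finset.range (a + 1),
      Polynomial.aeval (D + algebraMap ℂ A (((a - k : ℕ) : ℂ) / 2)) (SNat k (a - k)) *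
        d ^ (a - k) := by
  induction a with
  | zero => simp [SNat_zero]
  | succ a ih =>
    rw [pow_succ', ih, Finset.mul_sum, Finset.sum_range_succ' _ (a + 1)]
    simp only [add_mul, Finset.sum_add_distrib]
    rw [Finset.sum_range_succ' _ a, Finset.sum_range_succ _ a, Finset.sum_range_succ _ a]
    have hstep : ∀ k ∈ Finset.range a,
        Polynomial.aeval (D + algebraMap ℂ A (((a + 1 - (k + 1) : ℕ) : ℂ) / 2))
          (SNat (k + 1) (a + 1 - (k + 1))) * d ^ (a + 1 - (k + 1)) =
        d * (Polynomial.aeval (D + algebraMap ℂ A (((a - (k + 1) : ℕ) : ℂ) / 2))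
          (SNat (k + 1) (a - (k + 1))) * d ^ (a - (k + 1))) +
        D * (Polynomial.aeval (D + algebraMap ℂ A (((a - k : ℕ) : ℂ) / 2))
          (SNat k (a - k)) * d ^ (a - k)) := by
      intro k hk
      have hk' := Finset.mem_range.mp hk
      obtain ⟨b, rfl⟩ : ∃ b, a = k + 1 + b := ⟨a - (k + 1), by omega⟩
      have e1 : k + 1 + b + 1 - (k + 1) = b + 1 := by omega
      have e2 : k + 1 + b - k = b + 1 := by omega
      have e3 : k + 1 + b - (k + 1) = b := by omega
      rw [e1, e2, e3]
      -- A central shift of `D` does not change the commutator.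
      have hc : d * (D + algebraMap ℂ A ((b : ℂ) / 2)) - (D + algebraMap ℂ A ((b : ℂ) / 2)) * d
          = d := by
        rw [mul_add, add_mul, Algebra.commutes ((b : ℂ) / 2) d]
        rw [add_sub_add_right_eq_sub, hd]
      rw [← mul_assoc, mul_aeval_of_commutator hc, mul_assoc _ d, ← pow_succ', ← mul_assoc,
        ← add_mul]
      congr 1
      rw [SNat_succ_succ, map_add, map_mul, Polynomial.aeval_comp]
      congr 2
      · congr 2
        simp only [map_add, Polynomial.aeval_X, Polynomial.aeval_C]
        rw [add_assoc, add_assoc, ← map_add, ← map_one (algebraMap ℂ A), ← map_add]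
        congr 2
        push_cast
        ring
      · simp only [map_sub, map_mul, map_add, Polynomial.aeval_X, Polynomial.aeval_C,
          map_natCast, map_one]
        rw [show ((b : A) + 1) * algebraMap ℂ A (1 / 2) =
          algebraMap ℂ A (((b + 1 : ℕ) : ℂ) / 2) by
            rw [show (b : A) + 1 = algebraMap ℂ A ((b + 1 : ℕ) : ℂ) by simp, ← map_mul]
            congr 1
            ring]
        simp
    rw [Finset.sum_congr rfl hstep, Finset.sum_add_distrib]
    simp only [Nat.sub_self, SNat_zero, SNat_succ_zero, map_one, pow_zero, mul_one, one_mul,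
      Nat.sub_zero, Nat.cast_zero, zero_div, map_zero, add_zero, map_mul, Polynomial.aeval_X]
    rw [pow_succ' d a]
    abel

end

/-! ### The polynomials `S_k` at natural values of `β` -/

/-- The specialization of `S_k(D, β)` at a complex number `β`, as a polynomial in `D`. -/
noncomputable def SPoly (k : ℕ) (β : ℂ) : ℂ[X] :=
  (S k).map (Polynomial.aeval β : ℚ[X] →ₐ[ℚ] ℂ).toRingHom

theorem evalS_eq_aeval {A : Type*} [Ring A] [Algebra ℂ A] (k : ℕ) (D : A) (β : ℂ) :
    evalS k D β = Polynomial.aeval D (SPoly k β) := rfl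

theorem SPoly_eq (k : ℕ) (β : ℂ) : SPoly k β =
    Polynomial.C (∏ i ∈ Finset.Icc 1 k, (β + (i : ℂ))) *
      ∑ j ∈ Finset.range (k / 2 + 1),
        Polynomial.C ((((k - 2 * j).factorial : ℂ) * ((2 * j).factorial : ℂ))⁻¹ *
          Polynomial.aeval β (T j)) * Polynomial.X ^ (k - 2 * j) := by
  simp [SPoly, S, Polynomial.map_sum, Polynomial.map_prod]

theorem X_sq_dvd_sinhc_sub_one : (PowerSeries.X : PowerSeries ℚ) ^ 2 ∣ sinhc - 1 := by
  rw [PowerSeries.X_pow_dvd_iff]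
  intro m hm
  interval_cases m
  · rw [map_sub, sinhc, PowerSeries.coeff_mk, PowerSeries.coeff_one]
    simp
  · rw [map_sub, sinhc, PowerSeries.coeff_mk, PowerSeries.coeff_one]
    simp

theorem coeff_sinhc_sub_one_pow {j i : ℕ} (h : j < i) :
    PowerSeries.coeff (2 * j) ((sinhc - 1) ^ i) = 0 := by
  have h1 : (PowerSeries.X : PowerSeries ℚ) ^ (2 * i) ∣ (sinhc - 1) ^ i := by
    rw [pow_mul]
    exact pow_dvd_pow_of_dvd X_sq_dvd_sinhc_sub_one i
  exact PowerSeries.X_pow_dvd_iff.mp h1 _ (by omega)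

/-- This is the binomial expansion of `(1 + (sinhc - 1))^b`. Cutting it at `i ≤ j` loses nothing,
because `sinhc - 1` is divisible by `x²`. -/
theorem eval_T_natCast (j b : ℕ) : (T j).eval (b : ℚ) =
    ((2 * j).factorial : ℚ) * PowerSeries.coeff (2 * j) (sinhc ^ b) := by
  have h1 : PowerSeries.coeff (2 * j) (sinhc ^ b) = ∑ i ∈ Finset.range (b + 1),
      PowerSeries.coeff (2 * j) ((sinhc - 1) ^ i) * (b.choose i : ℚ) := by
    conv_lhs => rw [show sinhc = (sinhc - 1) + 1 by ring, add_pow, map_sum]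
    refine Finset.sum_congr rfl fun i _ => ?_
    rw [one_pow, mul_one, ← map_natCast (PowerSeries.C (R := ℚ)), PowerSeries.coeff_mul_C]
  have h2 : ∑ i ∈ Finset.range (b + 1),
      PowerSeries.coeff (2 * j) ((sinhc - 1) ^ i) * (b.choose i : ℚ) =
      ∑ i ∈ Finset.range (j + 1),
      PowerSeries.coeff (2 * j) ((sinhc - 1) ^ i) * (b.choose i : ℚ) := by
    rcases le_total b j with hbj | hbj
    · refine Finset.sum_subset (Finset.range_mono (by omega)) fun i _ hi => ?_
      rw [Nat.choose_eq_zero_of_lt (by simpa using hi)]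
      simp
    · refine (Finset.sum_subset (Finset.range_mono (by omega)) fun i _ hi => ?_).symm
      rw [coeff_sinhc_sub_one_pow (by simpa using hi)]
      simp
  rw [h1, h2, T, Polynomial.eval_mul, Polynomial.eval_C, Polynomial.eval_finsetSum]
  congr 1
  refine Finset.sum_congr rfl fun i _ => ?_
  rw [Polynomial.eval_mul, Polynomial.eval_C, descPochhammer_eval_eq_descFactorial,
    Nat.descFactorial_eq_factorial_mul_choose]
  have := Nat.factorial_ne_zero i
  push_cast
  field_simp

theorem coeff_sinhc_pow_odd {n : ℕ} (hn : Odd n) (b : ℕ) :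
    PowerSeries.coeff n (sinhc ^ b) = 0 := by
  have h1 : PowerSeries.rescale (-1) sinhc = sinhc := by
    ext1 m
    rw [PowerSeries.coeff_rescale, sinhc, PowerSeries.coeff_mk]
    split_ifs with h
    · rw [h.neg_one_pow, one_mul]
    · simp
  have h2 := PowerSeries.coeff_rescale (sinhc ^ b) (-1 : ℚ) n
  rw [map_pow, h1, hn.neg_one_pow] at h2
  linarith

theorem sinhCoeff_eq_sum (k b : ℕ) : sinhCoeff k b = ∑ j ∈ Finset.range (k / 2 + 1),
    Polynomial.C (((k - 2 * j).factorial : ℂ)⁻¹ *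
      ((PowerSeries.coeff (2 * j) (sinhc ^ b) : ℚ) : ℂ)) * Polynomial.X ^ (k - 2 * j) := by
  have hmap : ∀ r : ℚ, algebraMap ℚ ℂ[X] r = Polynomial.C (r : ℂ) := fun r => by
    rw [IsScalarTower.algebraMap_apply ℚ ℂ ℂ[X]]
    simp
  have hterm : ∀ m n : ℕ, PowerSeries.coeff m (expSer Polynomial.X) *
      PowerSeries.coeff n (sinhSer ^ b) = Polynomial.C ((m.factorial : ℂ)⁻¹ *
      ((PowerSeries.coeff n (sinhc ^ b) : ℚ) : ℂ)) * Polynomial.X ^ m := by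
    intro m n
    rw [expSer, PowerSeries.coeff_rescale, PowerSeries.coeff_exp, sinhSer, ← map_pow,
      PowerSeries.coeff_map, hmap, hmap, Polynomial.C_mul]
    push_cast
    rw [one_div]
    ring
  rw [sinhCoeff, PowerSeries.coeff_mul, Finset.sum_congr rfl fun x _ => hterm x.1 x.2]
  -- Since `sinhc ^ b` is even, only pairs with even second entry survive.
  refine (Finset.sum_bij_ne_zero (fun j _ _ => (k - 2 * j, 2 * j)) ?_ ?_ ?_ ?_).symm
  · intro j hj _
    have := Finset.mem_range.mp hj
    rw [Finset.HasAntidiagonal.mem_antidiagonal]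
    change k - 2 * j + 2 * j = k
    omega
  · intro a _ _ b _ _ h
    have := congrArg Prod.snd h
    change 2 * a = 2 * b at this
    omega
  · rintro ⟨m, n⟩ hmn hne
    rw [Finset.HasAntidiagonal.mem_antidiagonal] at hmn
    change m + n = k at hmn
    rcases Nat.even_or_odd n with he | ho
    · obtain ⟨j, rfl⟩ := he.two_dvd
      have hm : k - 2 * j = m := by omega
      refine ⟨j, Finset.mem_range.mpr (by omega), ?_, by simp [hm]⟩
      rw [hm]
      exact hne
    · exact absurd (by simp [coeff_sinhc_pow_odd ho]) hne
  · intro j _ _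
    rfl

theorem SPoly_natCast (k b : ℕ) : SPoly k (b : ℂ) = SNat k b := by
  rw [SPoly_eq, SNat, sinhCoeff_eq_sum]
  congr 1
  · simp
  · refine Finset.sum_congr rfl fun j _ => ?_
    have h1 : Polynomial.aeval (b : ℂ) (T j) = (((T j).eval (b : ℚ) : ℚ) : ℂ) := by
      rw [← eq_ratCast (algebraMap ℚ ℂ), ← Polynomial.aeval_algebraMap_apply_eq_algebraMap_eval]
      simp
    rw [h1, eval_T_natCast]
    have := Nat.factorial_ne_zero (2 * j)
    push_cast
    congr 2
    field_simp

theorem evalS_natCast {A : Type*} [Ring A] [Algebra ℂ A] (k : ℕ) (D : A) (b : ℕ) :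
    evalS k D (b : ℂ) = Polynomial.aeval D (SNat k b) := by
  rw [evalS_eq_aeval, SPoly_natCast]

theorem add_pow_eq_sum_evalS {A : Type*} [Ring A] [Algebra ℂ A] {d D : A}
    (hd : d * D - D * d = d) (a : ℕ) :
    (d + D) ^ a = ∑ k ∈ Finset.range (a + 1),
      evalS k (D + algebraMap ℂ A (((a : ℂ) - k) / 2)) ((a : ℂ) - k) * d ^ (a - k) := by
  rw [add_pow_of_commutator hd]
  refine Finset.sum_congr rfl fun k hk => ?_
  rw [← evalS_natCast, Nat.cast_sub (Finset.mem_range_succ_iff.mp hk)]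

/-! ### The action of `S_k` on formal series -/

/-- The index type is left free because this serves both `euler` on exponents in `ℚ` and `thetaOp`
on sequences indexed by `ℤ`. -/
theorem aeval_diagonal_apply {ι : Type*} {D : Module.End ℂ (ι → ℂ)} {v : ι → ℂ}
    (hD : ∀ x i, D x i = v i * x i) (p : ℂ[X]) (c : ℂ) (x : ι → ℂ) (i : ι) :
    Polynomial.aeval (D + algebraMap ℂ (Module.End ℂ (ι → ℂ)) c) p x i =
      p.eval (v i + c) * x i := by
  induction p using Polynomial.induction_on with
  | C a => simp
  | add p r hp hr => simp [hp, hr, add_mul]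
  | monomial n a ih =>
    have h1 : (Polynomial.C a * Polynomial.X ^ (n + 1) : ℂ[X]) =
      Polynomial.X * (Polynomial.C a * Polynomial.X ^ n) := by ring
    rw [h1, map_mul, Module.End.mul_apply, Polynomial.eval_mul, Polynomial.eval_X,
      Polynomial.aeval_X, LinearMap.add_apply, Pi.add_apply, Module.algebraMap_end_apply,
      Pi.smul_apply, hD, ih, smul_eq_mul]
    ring

theorem evalS_scalar (k : ℕ) (z β : ℂ) : evalS k z β = (SPoly k β).eval z := by
  rw [evalS_eq_aeval, Polynomial.coe_aeval_eq_eval]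

theorem evalS_euler_apply (k : ℕ) (c β : ℂ) (x : Ser) (q : ℚ) :
    evalS k (euler + algebraMap ℂ (Module.End ℂ Ser) c) β x q =
      evalS k ((q : ℂ) + c) β * x q := by
  rw [evalS_scalar, evalS_eq_aeval,
    aeval_diagonal_apply (v := fun q : ℚ => (q : ℂ)) fun _ _ => rfl]

theorem evalS_euler_mono (k : ℕ) (c β : ℂ) (q : ℚ) :
    evalS k (euler + algebraMap ℂ (Module.End ℂ Ser) c) β (mono q) =
      evalS k ((q : ℂ) + c) β • mono q := by
  funext r
  rw [evalS_euler_apply, Pi.smul_apply, smul_eq_mul]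
  by_cases h : r = q
  · rw [h]
  · rw [mono, Pi.single_eq_of_ne h, mul_zero, mul_zero]

theorem integ_pow_apply (k : ℕ) (x : Ser) (q : ℚ) :
    (integ ^ k) x q = x (q - k) / ∏ i ∈ Finset.range k, ((q : ℂ) - i) := by
  induction k generalizing q with
  | zero => simp
  | succ k ih =>
    rw [pow_succ', Module.End.mul_apply]
    change (integ ^ k) x (q - 1) / (q : ℂ) = _
    rw [ih, Finset.prod_range_succ', div_div]
    have h1 : q - 1 - k = q - ((k + 1 : ℕ) : ℚ) := by push_cast; ring
    rw [h1]
    congr 2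
    · refine Finset.prod_congr rfl fun i _ => ?_
      push_cast
      ring
    · simp

/-! ### Exponentials of power series without constant term -/

theorem coeff_pow_eq_zero {B : Type*} [CommRing B] {g : PowerSeries B} (hg : PowerSeries.coeff 0 g = 0) {N s : ℕ}
    (h : N < s) : PowerSeries.coeff N (g ^ s) = 0 := by
  have h1 : (PowerSeries.X : PowerSeries B) ∣ g :=
    PowerSeries.X_dvd_iff.mpr (by rwa [← PowerSeries.coeff_zero_eq_constantCoeff_apply])
  exact PowerSeries.X_pow_dvd_iff.mp (pow_dvd_pow_of_dvd h1 s) N h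

section FormalExp

variable {B : Type*} [CommRing B] [Algebra ℂ B]

/-- The exponential of a power series without constant term. -/
noncomputable def expS (g : PowerSeries B) : PowerSeries B :=
  PowerSeries.mk fun N => ∑ s ∈ Finset.range (N + 1),
    algebraMap ℂ B (1 / (s.factorial : ℂ)) * PowerSeries.coeff N (g ^ s)

/-- The derivation of `B⟦t⟧` acting on `b t ^ N` as `δ b t ^ N + c N b t ^ N`. -/
noncomputable def gradDer (δ : Derivation ℂ B B) (c : ℂ) (x : PowerSeries B) : PowerSeries B :=
  PowerSeries.mk fun N => δ (PowerSeries.coeff N x) +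
    algebraMap ℂ B (c * N) * PowerSeries.coeff N x

theorem coeff_gradDer (δ : Derivation ℂ B B) (c : ℂ) (x : PowerSeries B) (N : ℕ) :
    PowerSeries.coeff N (gradDer δ c x) = δ (PowerSeries.coeff N x) +
      algebraMap ℂ B (c * N) * PowerSeries.coeff N x :=
  PowerSeries.coeff_mk _ _

theorem gradDer_add (δ : Derivation ℂ B B) (c : ℂ) (x y : PowerSeries B) :
    gradDer δ c (x + y) = gradDer δ c x + gradDer δ c y := by
  ext1 N
  simp only [coeff_gradDer, map_add]
  ring

theorem gradDer_neg (δ : Derivation ℂ B B) (c : ℂ) (x : PowerSeries B) :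
    gradDer δ c (-x) = -gradDer δ c x := by
  ext1 N
  simp only [coeff_gradDer, map_neg]
  ring

theorem gradDer_sub (δ : Derivation ℂ B B) (c : ℂ) (x y : PowerSeries B) :
    gradDer δ c (x - y) = gradDer δ c x - gradDer δ c y := by
  rw [sub_eq_add_neg, gradDer_add, gradDer_neg, sub_eq_add_neg]

theorem gradDer_sum (δ : Derivation ℂ B B) (c : ℂ) {ι : Type*} (s : Finset ι)
    (x : ι → PowerSeries B) : gradDer δ c (∑ i ∈ s, x i) = ∑ i ∈ s, gradDer δ c (x i) := by
  ext1 N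
  simp only [coeff_gradDer, map_sum, Finset.mul_sum, Finset.sum_add_distrib]

theorem gradDer_mul (δ : Derivation ℂ B B) (c : ℂ) (x y : PowerSeries B) :
    gradDer δ c (x * y) = gradDer δ c x * y + x * gradDer δ c y := by
  ext1 N
  simp only [coeff_gradDer, map_add, PowerSeries.coeff_mul, map_sum, Finset.mul_sum,
    ← Finset.sum_add_distrib]
  refine Finset.sum_congr rfl fun p hp => ?_
  rw [← Finset.HasAntidiagonal.mem_antidiagonal.mp hp, Derivation.leibniz]
  simp only [smul_eq_mul, Nat.cast_add, mul_add, map_add]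
  ring

theorem gradDer_pow_succ (δ : Derivation ℂ B B) (c : ℂ) (x : PowerSeries B) (n : ℕ) :
    gradDer δ c (x ^ (n + 1)) = ((n : PowerSeries B) + 1) * (x ^ n * gradDer δ c x) := by
  induction n with
  | zero => simp
  | succ n ih =>
    rw [pow_succ, gradDer_mul, ih]
    push_cast
    ring

theorem gradDer_C (δ : Derivation ℂ B B) (c : ℂ) (b : B) :
    gradDer δ c (PowerSeries.C b) = PowerSeries.C (δ b) := by
  ext1 N
  rw [coeff_gradDer, PowerSeries.coeff_C, PowerSeries.coeff_C]
  split_ifs with h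
  · simp [h]
  · simp

theorem gradDer_X (δ : Derivation ℂ B B) (c : ℂ) :
    gradDer δ c (PowerSeries.X : PowerSeries B) =
      PowerSeries.C (algebraMap ℂ B c) * PowerSeries.X := by
  ext1 N
  rw [coeff_gradDer, PowerSeries.coeff_C_mul, PowerSeries.coeff_X]
  split_ifs with h
  · simp [h]
  · simp

theorem coeff_expS {g : PowerSeries B} (hg : PowerSeries.coeff 0 g = 0) {N M : ℕ} (h : N < M) :
    PowerSeries.coeff N (expS g) = PowerSeries.coeff N (∑ s ∈ Finset.range M,
      PowerSeries.C (algebraMap ℂ B (1 / (s.factorial : ℂ))) * g ^ s) := by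
  rw [expS, PowerSeries.coeff_mk, map_sum]
  simp only [PowerSeries.coeff_C_mul]
  refine Finset.sum_subset (Finset.range_mono h) fun s _ hs => ?_
  rw [coeff_pow_eq_zero hg (by simpa using hs), mul_zero]

theorem coeff_zero_expS (g : PowerSeries B) : PowerSeries.coeff 0 (expS g) = 1 := by
  rw [expS, PowerSeries.coeff_mk]
  simp

theorem gradDer_expS (δ : Derivation ℂ B B) (c : ℂ) {g : PowerSeries B}
    (hg : PowerSeries.coeff 0 g = 0) :
    gradDer δ c (expS g) = gradDer δ c g * expS g := by
  ext1 N
  -- Powers `g ^ s` with `s > N` do not reach `t ^ N`. One extra term is kept because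
  -- differentiation turns `g ^ (s + 1)` into a multiple of `g ^ s`.
  have h1 : PowerSeries.coeff N (gradDer δ c (expS g)) =
      PowerSeries.coeff N (gradDer δ c (∑ s ∈ Finset.range (N + 2),
        PowerSeries.C (algebraMap ℂ B (1 / (s.factorial : ℂ))) * g ^ s)) := by
    rw [coeff_gradDer, coeff_gradDer, coeff_expS hg (show N < N + 2 by omega)]
  have h2 : gradDer δ c (∑ s ∈ Finset.range (N + 2),
      PowerSeries.C (algebraMap ℂ B (1 / (s.factorial : ℂ))) * g ^ s) =
      gradDer δ c g * ∑ s ∈ Finset.range (N + 1),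
        PowerSeries.C (algebraMap ℂ B (1 / (s.factorial : ℂ))) * g ^ s := by
    rw [gradDer_sum, Finset.sum_range_succ', Finset.mul_sum]
    have h0 : gradDer δ c (PowerSeries.C (algebraMap ℂ B (1 / ((0 : ℕ).factorial : ℂ))) * g ^ 0)
        = 0 := by
      rw [pow_zero, mul_one, gradDer_C, Derivation.map_algebraMap, map_zero]
    rw [h0, add_zero]
    refine Finset.sum_congr rfl fun s _ => ?_
    rw [gradDer_mul, gradDer_C, Derivation.map_algebraMap, map_zero, zero_mul, zero_add,
      gradDer_pow_succ]
    have h3 : algebraMap ℂ B (1 / (s.factorial : ℂ)) =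
        algebraMap ℂ B (1 / ((s + 1).factorial : ℂ)) * ((s : B) + 1) := by
      rw [show (s : B) + 1 = algebraMap ℂ B ((s : ℂ) + 1) by simp, ← map_mul]
      congr 1
      have := Nat.cast_add_one_ne_zero (R := ℂ) s
      rw [Nat.factorial_succ]
      push_cast
      field_simp
    rw [h3, map_mul, map_add, map_natCast, map_one]
    ring
  rw [h1, h2, PowerSeries.coeff_mul, PowerSeries.coeff_mul]
  refine Finset.sum_congr rfl fun p hp => ?_
  rw [coeff_expS hg (M := N + 1)]
  have := Finset.HasAntidiagonal.mem_antidiagonal.mp hp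
  omega

/-- As `h` has no constant term, the equation determines `N` times the `N`-th coefficient from the
earlier ones. -/
theorem eq_of_euler_ode {h y z : PowerSeries B} (hh : PowerSeries.coeff 0 h = 0)
    (hy : gradDer 0 1 y = h * y) (hz : gradDer 0 1 z = h * z)
    (h0 : PowerSeries.coeff 0 y = PowerSeries.coeff 0 z) : y = z := by
  ext1 N
  induction N using Nat.strong_induction_on with
  | _ N ih =>
    rcases Nat.eq_zero_or_pos N with rfl | hN
    · exact h0
    · have e1 := congrArg (PowerSeries.coeff N) hy
      have e2 := congrArg (PowerSeries.coeff N) hz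
      have e3 : PowerSeries.coeff N (h * y) = PowerSeries.coeff N (h * z) := by
        rw [PowerSeries.coeff_mul, PowerSeries.coeff_mul]
        refine Finset.sum_congr rfl fun p hp => ?_
        have hp' := Finset.HasAntidiagonal.mem_antidiagonal.mp hp
        rcases Nat.eq_zero_or_pos p.1 with h1 | h1
        · rw [h1, hh, zero_mul, zero_mul]
        · rw [ih p.2 (by omega)]
      rw [e3, ← e2, coeff_gradDer, coeff_gradDer] at e1
      simp only [Derivation.zero_apply, zero_add, one_mul] at e1
      have h4 := congrArg (algebraMap ℂ B ((N : ℂ)⁻¹) * ·) e1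
      simp only [← mul_assoc, ← map_mul] at h4
      rw [inv_mul_cancel₀ (by exact_mod_cast hN.ne'), map_one, one_mul, one_mul] at h4
      exact h4

theorem eq_expS_of_euler_ode {g y : PowerSeries B} (hg : PowerSeries.coeff 0 g = 0)
    (hy : gradDer 0 1 y = gradDer 0 1 g * y) (h0 : PowerSeries.coeff 0 y = 1) : y = expS g := by
  refine eq_of_euler_ode ?_ hy (gradDer_expS 0 1 hg) (by rw [h0, coeff_zero_expS])
  rw [coeff_gradDer, hg]
  simp

theorem expS_add {g k : PowerSeries B} (hg : PowerSeries.coeff 0 g = 0)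
    (hk : PowerSeries.coeff 0 k = 0) : expS (g + k) = expS g * expS k := by
  refine (eq_expS_of_euler_ode (by rw [map_add, hg, hk, add_zero]) ?_ ?_).symm
  · rw [gradDer_mul, gradDer_expS 0 1 hg, gradDer_expS 0 1 hk, gradDer_add]
    ring
  · rw [PowerSeries.coeff_mul]
    simp [coeff_zero_expS, -PowerSeries.coeff_zero_eq_constantCoeff]

theorem map_expS {B' : Type*} [CommRing B'] [Algebra ℂ B'] (φ : B →ₐ[ℂ] B')
    (g : PowerSeries B) :
    (expS g).map (φ : B →+* B') = expS (g.map (φ : B →+* B')) := by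
  ext1 N
  rw [PowerSeries.coeff_map, expS, expS, PowerSeries.coeff_mk, PowerSeries.coeff_mk, map_sum]
  refine Finset.sum_congr rfl fun s _ => ?_
  rw [map_mul, ← map_pow, PowerSeries.coeff_map]
  simp

/-- `(1 + w t) ^ β` as a power series in `t`. -/
noncomputable def binomSer (w : B) (β : ℂ) : PowerSeries B :=
  PowerSeries.mk fun N => algebraMap ℂ B ((descPochhammer ℂ N).eval β / (N.factorial : ℂ)) * w ^ N

/-- `β log (1 + w t)` as a power series in `t`. -/
noncomputable def logSer (w : B) (β : ℂ) : PowerSeries B :=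
  PowerSeries.mk fun N => algebraMap ℂ B (-β * (-1) ^ N / N) * w ^ N

theorem gradDer_logSer (w : B) (β : ℂ) :
    (1 + PowerSeries.C w * PowerSeries.X) * gradDer 0 1 (logSer w β) =
      PowerSeries.C (algebraMap ℂ B β * w) * PowerSeries.X := by
  rw [add_mul, one_mul, mul_comm (PowerSeries.C w) PowerSeries.X, mul_assoc,
    mul_comm _ PowerSeries.X]
  ext1 N
  cases N with
  | zero =>
    rw [map_add, PowerSeries.coeff_zero_X_mul, PowerSeries.coeff_zero_X_mul, coeff_gradDer]
    simp
  | succ N =>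
    rw [map_add, PowerSeries.coeff_succ_X_mul, PowerSeries.coeff_succ_X_mul,
      PowerSeries.coeff_C_mul, PowerSeries.coeff_C, coeff_gradDer, coeff_gradDer, logSer,
      PowerSeries.coeff_mk, PowerSeries.coeff_mk]
    simp only [Derivation.zero_apply, zero_add, one_mul, ← mul_assoc, ← map_mul]
    have e1 : ((N + 1 : ℕ) : ℂ) * (-β * (-1) ^ (N + 1) / ((N + 1 : ℕ) : ℂ)) = β * (-1) ^ N := by
      have := Nat.cast_ne_zero (R := ℂ).mpr (Nat.succ_ne_zero N)
      field_simp
      ring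
    rw [e1]
    split_ifs with h
    · simp [h]
    · have e2 : (N : ℂ) * (-β * (-1) ^ N / (N : ℂ)) = -(β * (-1) ^ N) := by
        have := Nat.cast_ne_zero (R := ℂ).mpr h
        field_simp
      rw [mul_comm w, e2, map_neg]
      ring

theorem gradDer_binomSer (w : B) (β : ℂ) :
    (1 + PowerSeries.C w * PowerSeries.X) * gradDer 0 1 (binomSer w β) =
      PowerSeries.C (algebraMap ℂ B β * w) * PowerSeries.X * binomSer w β := by
  rw [add_mul, one_mul, mul_comm (PowerSeries.C w) PowerSeries.X, mul_assoc,
    mul_comm _ PowerSeries.X, mul_assoc]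
  ext1 N
  cases N with
  | zero =>
    rw [map_add, PowerSeries.coeff_zero_X_mul, PowerSeries.coeff_zero_X_mul, coeff_gradDer]
    simp
  | succ N =>
    rw [map_add, PowerSeries.coeff_succ_X_mul, PowerSeries.coeff_succ_X_mul,
      PowerSeries.coeff_C_mul, PowerSeries.coeff_C_mul, coeff_gradDer, coeff_gradDer, binomSer,
      PowerSeries.coeff_mk, PowerSeries.coeff_mk]
    simp only [Derivation.zero_apply, zero_add, one_mul]
    have e1 : ((N + 1 : ℕ) : ℂ) *
        ((descPochhammer ℂ (N + 1)).eval β / ((N + 1).factorial : ℂ)) =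
        (β - N) * ((descPochhammer ℂ N).eval β / (N.factorial : ℂ)) := by
      have := Nat.cast_ne_zero (R := ℂ).mpr (Nat.succ_ne_zero N)
      have := Nat.cast_ne_zero (R := ℂ).mpr (Nat.factorial_ne_zero N)
      rw [descPochhammer_succ_eval, Nat.factorial_succ]
      push_cast at *
      field_simp
    rw [← mul_assoc, ← map_mul, e1]
    simp only [map_mul, map_sub]
    ring

theorem coeff_zero_logSer (w : B) (β : ℂ) : PowerSeries.coeff 0 (logSer w β) = 0 := by
  rw [logSer, PowerSeries.coeff_mk]
  simp

/-- Both sides solve `(1 + wt) t∂_t y = β w t y` with constant term `1`; the domain hypothesis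
serves to cancel `1 + wt`. -/
theorem binomSer_eq_expS [IsDomain B] (w : B) (β : ℂ) : binomSer w β = expS (logSer w β) := by
  refine eq_expS_of_euler_ode (coeff_zero_logSer w β) ?_ ?_
  · have hne : (1 + PowerSeries.C w * PowerSeries.X : PowerSeries B) ≠ 0 := by
      intro h
      have := congrArg (PowerSeries.coeff 0) h
      simp at this
    apply mul_left_cancel₀ hne
    rw [gradDer_binomSer, ← mul_assoc, gradDer_logSer]
  · rw [binomSer, PowerSeries.coeff_mk]
    simp

theorem binomSer_natCast (w : B) (a : ℕ) :
    binomSer w (a : ℂ) = (1 + PowerSeries.C w * PowerSeries.X) ^ a := by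
  rw [add_comm, add_pow]
  ext1 N
  simp only [map_sum, one_pow, mul_one, mul_pow, ← map_pow, binomSer, PowerSeries.coeff_mk]
  simp only [← map_natCast (PowerSeries.C (R := B)), PowerSeries.coeff_mul_C,
    PowerSeries.coeff_C_mul, PowerSeries.coeff_X_pow]
  rw [descPochhammer_eval_eq_descFactorial, Nat.descFactorial_eq_factorial_mul_choose,
    Nat.cast_mul, mul_div_cancel_left₀ _ (Nat.cast_ne_zero.mpr (Nat.factorial_ne_zero N)),
    map_natCast]
  rcases lt_or_ge N (a + 1) with h | h
  · rw [Finset.sum_eq_single N]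
    · simp [mul_comm]
    · intro b _ hb
      simp [hb.symm]
    · intro hb
      exact absurd (Finset.mem_range.mpr h) hb
  · rw [Nat.choose_eq_zero_of_lt (by omega), Finset.sum_eq_zero]
    · simp
    · intro i hi
      have := Finset.mem_range.mp hi
      have hNi : N ≠ i := by omega
      simp [hNi]

end FormalExp

/-! ### Series with coefficients polynomial in `τ`, and formal Gaussian integration -/

section Growth

variable {R : Type*} [CommRing R]

/-- The coefficient of `t ^ N` has degree at most `(3 N + K) / 2`. -/
def Growth (K : ℕ) (x : PowerSeries R[X]) : Prop :=
  ∀ N, 2 * (PowerSeries.coeff N x).natDegree ≤ 3 * N + K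

/-- This makes Gaussian integration finite: `t^N τ^p` contributes to `t^(N - (p+1)/2)`, and `2p ≤ 3N
+ K` leaves finitely many pairs for each exponent. -/
theorem Growth.coeff_eq_zero {K : ℕ} {x : PowerSeries R[X]} (h : Growth K x) {N p : ℕ}
    (hp : 3 * N + K < 2 * p) : (PowerSeries.coeff N x).coeff p = 0 :=
  Polynomial.coeff_eq_zero_of_natDegree_lt (by have := h N; omega)

theorem Growth.mono {K L : ℕ} {x : PowerSeries R[X]} (h : Growth K x) (hKL : K ≤ L) :
    Growth L x := fun N => (h N).trans (by omega)

theorem Growth.add {K : ℕ} {x y : PowerSeries R[X]} (hx : Growth K x) (hy : Growth K y) :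
    Growth K (x + y) := fun N => by
  rw [map_add]
  have h1 := Polynomial.natDegree_add_le (PowerSeries.coeff N x) (PowerSeries.coeff N y)
  have h2 := hx N
  have h3 := hy N
  rcases max_choice (PowerSeries.coeff N x).natDegree (PowerSeries.coeff N y).natDegree
    with h | h <;> omega

theorem Growth.neg {K : ℕ} {x : PowerSeries R[X]} (hx : Growth K x) : Growth K (-x) := fun N => by
  rw [map_neg, Polynomial.natDegree_neg]
  exact hx N

theorem Growth.sub {K : ℕ} {x y : PowerSeries R[X]} (hx : Growth K x) (hy : Growth K y) :
    Growth K (x - y) := by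
  rw [sub_eq_add_neg]
  exact hx.add hy.neg

theorem Growth.mul {K L : ℕ} {x y : PowerSeries R[X]} (hx : Growth K x) (hy : Growth L y) :
    Growth (K + L) (x * y) := fun N => by
  rw [PowerSeries.coeff_mul]
  have key : (∑ p ∈ Finset.HasAntidiagonal.antidiagonal N, PowerSeries.coeff p.1 x *
      PowerSeries.coeff p.2 y).natDegree ≤ (3 * N + (K + L)) / 2 := by
    refine Polynomial.natDegree_sum_le_of_forall_le _ _ fun p hp => ?_
    have h0 := Finset.HasAntidiagonal.mem_antidiagonal.mp hp
    have h1 := Polynomial.natDegree_mul_le (p := PowerSeries.coeff p.1 x)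
      (q := PowerSeries.coeff p.2 y)
    have h2 := hx p.1
    have h3 := hy p.2
    omega
  omega

theorem growth_C {K : ℕ} {p : R[X]} (hp : 2 * p.natDegree ≤ K) :
    Growth K (PowerSeries.C p) := fun N => by
  rw [PowerSeries.coeff_C]
  split_ifs
  · omega
  · simp

theorem growth_one : Growth 0 (1 : PowerSeries R[X]) := by
  rw [← map_one (PowerSeries.C (R := R[X]))]
  exact growth_C (by simp)

theorem growth_C_mul_X {p : R[X]} {K : ℕ} (hp : 2 * p.natDegree ≤ 3 + K) :
    Growth K (PowerSeries.C p * PowerSeries.X) := fun N => by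
  rw [PowerSeries.coeff_C_mul, PowerSeries.coeff_X]
  split_ifs with h
  · rw [mul_one, h]
    omega
  · simp

theorem Growth.pow {x : PowerSeries R[X]} (hx : Growth 0 x) (n : ℕ) : Growth 0 (x ^ n) := by
  induction n with
  | zero => simpa using growth_one
  | succ n ih => simpa [pow_succ] using ih.mul hx

theorem Growth.expS [Algebra ℂ R] {g : PowerSeries R[X]} (hg : Growth 0 g) :
    Growth 0 (expS g) := fun N => by
  rw [Nir.expS, PowerSeries.coeff_mk]
  have key : (∑ s ∈ Finset.range (N + 1), algebraMap ℂ R[X] (1 / (s.factorial : ℂ)) *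
      PowerSeries.coeff N (g ^ s)).natDegree ≤ (3 * N) / 2 := by
    refine Polynomial.natDegree_sum_le_of_forall_le _ _ fun s _ => ?_
    have h1 := Polynomial.natDegree_C_mul_le (algebraMap ℂ R (1 / (s.factorial : ℂ)))
      (PowerSeries.coeff N (g ^ s))
    have h2 := hg.pow s N
    rw [Polynomial.algebraMap_apply]
    omega
  omega

end Growth

section GaussInt

variable {R : Type*} [CommRing R] [Algebra ℂ R]

/-- Differentiation with respect to `τ`, as a `ℂ`-derivation. -/
noncomputable def derivTau : Derivation ℂ R[X] R[X] :=
  (Polynomial.derivative' (R := R)).restrictScalars ℂ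

theorem derivTau_apply (p : R[X]) : derivTau p = Polynomial.derivative p := rfl

/-- The coefficient of `t ^ (m - 1/2)` in the series obtained from `x` by replacing
`τ ^ (2 r)` by `μ r t ^ (-r - 1/2)` and odd powers of `τ` by `0`. All the terms that occur are
taken into account as soon as `Growth 1 x`. -/
noncomputable def gaussInt (μ : ℕ → ℂ) (x : PowerSeries R[X]) (m : ℕ) : R :=
  ∑ r ∈ Finset.range (4 * m + 4),
    algebraMap ℂ R (μ r) * (PowerSeries.coeff (m + r) x).coeff (2 * r)

variable {μ : ℕ → ℂ}

theorem gaussInt_add (x y : PowerSeries R[X]) (m : ℕ) :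
    gaussInt μ (x + y) m = gaussInt μ x m + gaussInt μ y m := by
  simp only [gaussInt, map_add, Polynomial.coeff_add, mul_add, Finset.sum_add_distrib]

theorem gaussInt_neg (x : PowerSeries R[X]) (m : ℕ) :
    gaussInt μ (-x) m = -gaussInt μ x m := by
  simp only [gaussInt, map_neg, Polynomial.coeff_neg, mul_neg, Finset.sum_neg_distrib]

theorem gaussInt_sub (x y : PowerSeries R[X]) (m : ℕ) :
    gaussInt μ (x - y) m = gaussInt μ x m - gaussInt μ y m := by
  rw [sub_eq_add_neg, gaussInt_add, gaussInt_neg, sub_eq_add_neg]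

theorem gaussInt_C_mul (z : R) (x : PowerSeries R[X]) (m : ℕ) :
    gaussInt μ (PowerSeries.C (Polynomial.C z) * x) m = z * gaussInt μ x m := by
  simp only [gaussInt, PowerSeries.coeff_C_mul, Polynomial.coeff_C_mul, Finset.mul_sum,
    mul_left_comm z]

/-- A nonzero coefficient of `t^(m+r) τ^(2r)` requires `4r ≤ 3(m+r) + 1`, that is `r ≤ 3m + 1`;
every longer cutoff gives the same value. -/
theorem gaussInt_eq_sum {x : PowerSeries R[X]} (hx : Growth 1 x) {m M : ℕ} (hM : 3 * m + 2 ≤ M) :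
    gaussInt μ x m = ∑ r ∈ Finset.range M,
      algebraMap ℂ R (μ r) * (PowerSeries.coeff (m + r) x).coeff (2 * r) := by
  have aux : ∀ A C : ℕ, 3 * m + 2 ≤ A → A ≤ C → ∑ r ∈ Finset.range A,
      algebraMap ℂ R (μ r) * (PowerSeries.coeff (m + r) x).coeff (2 * r) =
      ∑ r ∈ Finset.range C,
      algebraMap ℂ R (μ r) * (PowerSeries.coeff (m + r) x).coeff (2 * r) := by
    intro A C hA hAC
    refine Finset.sum_subset (Finset.range_mono hAC) fun r _ hr => ?_
    have hr' : A ≤ r := by simpa using hr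
    rw [hx.coeff_eq_zero (by omega), mul_zero]
  rw [gaussInt]
  rcases le_total M (4 * m + 4) with h | h
  · exact (aux _ _ hM h).symm
  · exact aux _ _ (by omega) h

theorem gaussInt_X_mul_succ {x : PowerSeries R[X]} (hx : Growth 1 x) (m : ℕ) :
    gaussInt μ (PowerSeries.X * x) (m + 1) = gaussInt μ x m := by
  rw [gaussInt_eq_sum hx (show 3 * m + 2 ≤ 4 * (m + 1) + 4 by omega), gaussInt]
  refine Finset.sum_congr rfl fun r _ => ?_
  rw [add_right_comm, PowerSeries.coeff_succ_X_mul]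

/-- The value is the coefficient of index `-1` of the integral of `x`, which the growth bound kills.
-/
theorem gaussInt_X_mul_zero {x : PowerSeries R[X]} (hx : Growth 1 x) :
    gaussInt μ (PowerSeries.X * x) 0 = 0 := by
  rw [gaussInt]
  refine Finset.sum_eq_zero fun r _ => ?_
  rw [zero_add]
  cases r with
  | zero => rw [PowerSeries.coeff_zero_X_mul, Polynomial.coeff_zero, mul_zero]
  | succ r => rw [PowerSeries.coeff_succ_X_mul, hx.coeff_eq_zero (by omega), mul_zero]

/-- The integrand is `∂_τ` of `x` times the kernel `exp(-a τ² t / 2)`; the hypothesis on `μ` is the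
moment recursion of that kernel. -/
theorem gaussInt_integration_by_parts {a : ℂ} (hμ : ∀ r, a * μ (r + 1) = (2 * r + 1) * μ r)
    {x : PowerSeries R[X]} (hx : Growth 0 x) (m : ℕ) :
    gaussInt μ (gradDer derivTau 0 x -
      PowerSeries.X * (PowerSeries.C (Polynomial.C (algebraMap ℂ R a) * Polynomial.X) * x)) m
      = 0 := by
  set y : PowerSeries R[X] :=
    PowerSeries.X * (PowerSeries.C (Polynomial.C (algebraMap ℂ R a) * Polynomial.X) * x) with hy
  have h0 : ∀ N, (PowerSeries.coeff N y).coeff 0 = 0 := by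
    intro N
    cases N with
    | zero => rw [hy, PowerSeries.coeff_zero_X_mul, Polynomial.coeff_zero]
    | succ N =>
      rw [hy, PowerSeries.coeff_succ_X_mul, PowerSeries.coeff_C_mul, mul_assoc,
        Polynomial.coeff_C_mul, Polynomial.coeff_X_mul_zero, mul_zero]
  have h1 : ∀ N p, (PowerSeries.coeff (N + 1) y).coeff (p + 1) =
      algebraMap ℂ R a * (PowerSeries.coeff N x).coeff p := by
    intro N p
    rw [hy, PowerSeries.coeff_succ_X_mul, PowerSeries.coeff_C_mul, mul_assoc,
        Polynomial.coeff_C_mul, Polynomial.coeff_X_mul]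
  have hterm : ∀ r, algebraMap ℂ R (μ r) *
      (PowerSeries.coeff (m + r) (gradDer derivTau 0 x - y)).coeff (2 * r) =
      algebraMap ℂ R (μ (r + 1)) * (PowerSeries.coeff (m + (r + 1)) y).coeff (2 * (r + 1)) -
      algebraMap ℂ R (μ r) * (PowerSeries.coeff (m + r) y).coeff (2 * r) := by
    intro r
    rw [map_sub, Polynomial.coeff_sub, mul_sub]
    congr 1
    rw [← add_assoc, show 2 * (r + 1) = 2 * r + 1 + 1 by ring, h1, ← mul_assoc, ← map_mul,
      mul_comm _ a, hμ, coeff_gradDer, derivTau_apply]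
    simp only [zero_mul, map_zero, add_zero, Polynomial.coeff_derivative]
    simp only [map_mul, map_add, map_natCast, map_one, map_ofNat, Nat.cast_mul, Nat.cast_ofNat]
    ring
  -- The sum telescopes: the lower end vanishes because `y` is divisible by `τ`, the upper end by
  -- the growth bound.
  rw [gaussInt, Finset.sum_congr rfl fun r _ => hterm r, Finset.sum_range_sub
    (fun r => algebraMap ℂ R (μ r) * (PowerSeries.coeff (m + r) y).coeff (2 * r))]
  rw [mul_zero, h0, mul_zero, sub_zero, show m + (4 * m + 4) = (5 * m + 3) + 1 by ring,
    show 2 * (4 * m + 4) = (8 * m + 7) + 1 by ring, h1, hx.coeff_eq_zero (by omega), mul_zero,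
    mul_zero]

/-- Differentiation under the integral: `t∂_t` acts on `x` and on the kernel `exp(-a τ² t / 2)`, and
multiplies `t^(m - 1/2)` by its exponent. -/
theorem gaussInt_euler {a : ℂ} (hμ : ∀ r, a * μ (r + 1) = (2 * r + 1) * μ r)
    {x : PowerSeries R[X]} (hx : Growth 0 x) (m : ℕ) :
    gaussInt μ (gradDer 0 1 x - PowerSeries.X * (PowerSeries.C
      (Polynomial.C (algebraMap ℂ R (a / 2)) * Polynomial.X ^ 2) * x)) m
      = algebraMap ℂ R (m - 1 / 2) * gaussInt μ x m := by
  set y : PowerSeries R[X] := PowerSeries.X * (PowerSeries.C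
      (Polynomial.C (algebraMap ℂ R (a / 2)) * Polynomial.X ^ 2) * x) with hy
  have h0 : ∀ N, (PowerSeries.coeff N y).coeff 0 = 0 := by
    intro N
    cases N with
    | zero => rw [hy, PowerSeries.coeff_zero_X_mul, Polynomial.coeff_zero]
    | succ N =>
      rw [hy, PowerSeries.coeff_succ_X_mul, PowerSeries.coeff_C_mul, mul_assoc,
        Polynomial.coeff_C_mul, pow_two, mul_assoc, Polynomial.coeff_X_mul_zero, mul_zero]
  have h1 : ∀ N p, (PowerSeries.coeff (N + 1) y).coeff (p + 2) =
      algebraMap ℂ R (a / 2) * (PowerSeries.coeff N x).coeff p := by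
    intro N p
    rw [hy, PowerSeries.coeff_succ_X_mul, PowerSeries.coeff_C_mul, mul_assoc,
        Polynomial.coeff_C_mul, Polynomial.coeff_X_pow_mul]
  have hterm : ∀ r, algebraMap ℂ R (μ r) *
      (PowerSeries.coeff (m + r) (gradDer 0 1 x - y)).coeff (2 * r) =
      algebraMap ℂ R (m - 1 / 2) *
        (algebraMap ℂ R (μ r) * (PowerSeries.coeff (m + r) x).coeff (2 * r)) +
      (algebraMap ℂ R (μ (r + 1)) * (PowerSeries.coeff (m + (r + 1)) y).coeff (2 * (r + 1)) -
      algebraMap ℂ R (μ r) * (PowerSeries.coeff (m + r) y).coeff (2 * r)) := by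
    intro r
    have hμ' : μ (r + 1) * (a / 2) = (r + 1 / 2) * μ r := by
      linear_combination (1 / 2) * hμ r
    rw [map_sub, Polynomial.coeff_sub, mul_sub, ← add_sub_assoc]
    congr 1
    rw [← add_assoc, show 2 * (r + 1) = 2 * r + 2 by ring, h1, ← mul_assoc, ← mul_assoc,
      ← map_mul, ← map_mul, hμ', ← add_mul, ← map_add, coeff_gradDer, Derivation.zero_apply,
      zero_add, one_mul, Polynomial.algebraMap_apply, Polynomial.coeff_C_mul, ← mul_assoc,
      ← map_mul]
    congr 2
    push_cast
    ring
  rw [gaussInt, Finset.sum_congr rfl fun r _ => hterm r, Finset.sum_add_distrib,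
    ← Finset.mul_sum, Finset.sum_range_sub
    (fun r => algebraMap ℂ R (μ r) * (PowerSeries.coeff (m + r) y).coeff (2 * r))]
  rw [mul_zero, h0, mul_zero, sub_zero, show m + (4 * m + 4) = (5 * m + 3) + 1 by ring,
    show 2 * (4 * m + 4) = (8 * m + 6) + 2 by ring, h1, hx.coeff_eq_zero (by omega), mul_zero,
    mul_zero, add_zero, gaussInt]

theorem gaussInt_map {R' : Type*} [CommRing R'] [Algebra ℂ R'] (φ : R →ₐ[ℂ] R')
    (x : PowerSeries R[X]) (m : ℕ) :
    gaussInt μ (x.map (Polynomial.mapRingHom (φ : R →+* R'))) m = φ (gaussInt μ x m) := by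
  simp [gaussInt, map_sum]

end GaussInt

/-! ### The polynomials `β*_k` -/

theorem derivative_betaStar (k : ℕ) : Polynomial.derivative (betaStar (k + 1)) =
    Polynomial.C ((k : ℂ) + 1) * betaStar k := by
  have h1 : Polynomial.C (1 / (((k + 1 : ℕ) : ℂ) + 1)) * ((k : ℂ[X]) + 1 + 1) = 1 := by
    rw [show (k : ℂ[X]) + 1 + 1 = Polynomial.C (((k + 1 : ℕ) : ℂ) + 1) by simp,
      ← Polynomial.C_mul, one_div, inv_mul_cancel₀ (Nat.cast_add_one_ne_zero _),
      Polynomial.C_1]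
  have h2 : Polynomial.C ((k : ℂ) + 1) * Polynomial.C (1 / ((k : ℂ) + 1)) = 1 := by
    rw [← Polynomial.C_mul, one_div, mul_inv_cancel₀ (Nat.cast_add_one_ne_zero _),
      Polynomial.C_1]
  rw [betaStar, betaStar, Polynomial.derivative_C_mul, Polynomial.derivative_comp,
    Polynomial.derivative_map, Polynomial.derivative_bernoulli_add_one]
  simp only [Polynomial.map_mul, Polynomial.map_add, Polynomial.map_natCast, Polynomial.map_one,
    Polynomial.mul_comp, Polynomial.add_comp, Polynomial.natCast_comp, Polynomial.one_comp,
    Polynomial.derivative_add, Polynomial.derivative_X, Polynomial.derivative_C, add_zero, one_mul]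
  push_cast at h1 ⊢
  rw [← mul_assoc, ← mul_assoc, h1, h2]

theorem betaStar_zero : betaStar 0 = Polynomial.X := by
  rw [betaStar, zero_add, Polynomial.bernoulli_one]
  simp

theorem bernoulli_two_eq : Polynomial.bernoulli 2 =
    (Polynomial.X ^ 2 - Polynomial.X + Polynomial.C (1 / 6) : ℚ[X]) := by
  rw [Polynomial.bernoulli]
  simp only [Finset.sum_range_succ, Finset.sum_range_zero, _root_.bernoulli_zero,
    _root_.bernoulli_one, _root_.bernoulli_two]
  simp only [← Polynomial.C_mul_X_pow_eq_monomial]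
  norm_num
  ring

theorem betaStar_one : betaStar 1 =
    Polynomial.C (1 / 2) * Polynomial.X ^ 2 - Polynomial.C (1 / 24) := by
  rw [betaStar, bernoulli_two_eq]
  apply Polynomial.funext
  intro x
  simp
  ring

/-- The relation `B_{k+1}(x+1) - B_{k+1}(x) = (k+1) x^k` at `x = τ - 1/2`. Summed over `k`, it says
that `f^↑(n,τ) - f^↑(n,τ-1) = f((τ - 1/2)/n)`. -/
theorem betaStar_sub_comp (k : ℕ) : betaStar k - (betaStar k).comp (Polynomial.X - 1) =
    (Polynomial.X - Polynomial.C (1 / 2)) ^ k := by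
  have h1 := congrArg (fun p : ℚ[X] => (p.map (algebraMap ℚ ℂ)).comp
    (Polynomial.X - Polynomial.C (1 / 2))) (Polynomial.bernoulli_comp_one_add_X (k + 1))
  simp only [Polynomial.map_comp, Polynomial.map_add, Polynomial.map_one, Polynomial.map_X,
    Polynomial.comp_assoc, Polynomial.add_comp, Polynomial.one_comp, Polynomial.X_comp,
    nsmul_eq_mul, Polynomial.map_mul, Polynomial.map_natCast, Polynomial.map_pow,
    Polynomial.mul_comp, Polynomial.natCast_comp, Polynomial.pow_comp, Nat.add_sub_cancel] at h1
  rw [betaStar, Polynomial.mul_comp, Polynomial.C_comp, Polynomial.comp_assoc]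
  have e1 : (Polynomial.X + Polynomial.C (1 / 2) : ℂ[X]) =
      1 + (Polynomial.X - Polynomial.C (1 / 2)) := by
    have : (Polynomial.C (1 / 2) + Polynomial.C (1 / 2) : ℂ[X]) = 1 := by
      rw [← Polynomial.C_add]; norm_num
    linear_combination this
  have e2 : (Polynomial.X + Polynomial.C (1 / 2) : ℂ[X]).comp (Polynomial.X - 1) =
      Polynomial.X - Polynomial.C (1 / 2) := by
    rw [e1]
    simp
    ring
  have e3 : Polynomial.C (1 / ((k : ℂ) + 1)) * ((k + 1 : ℕ) : ℂ[X]) = 1 := by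
    rw [show ((k + 1 : ℕ) : ℂ[X]) = Polynomial.C ((k : ℂ) + 1) by simp,
      ← Polynomial.C_mul, one_div, inv_mul_cancel₀ (Nat.cast_add_one_ne_zero _),
      Polynomial.C_1]
  rw [e2, e1]
  linear_combination Polynomial.C (1 / ((k : ℂ) + 1)) * h1 +
    (Polynomial.X - Polynomial.C (1 / 2)) ^ k * e3

theorem natDegree_betaStar_le (k : ℕ) : (betaStar k).natDegree ≤ k + 1 := by
  have h1 : (Polynomial.bernoulli (k + 1)).natDegree ≤ k + 1 := by
    rw [Polynomial.bernoulli]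
    refine Polynomial.natDegree_sum_le_of_forall_le _ _ fun i _ => ?_
    exact (Polynomial.natDegree_monomial_le _).trans (by omega)
  refine (Polynomial.natDegree_C_mul_le _ _).trans ?_
  refine Polynomial.natDegree_comp_le.trans ?_
  rw [Polynomial.natDegree_X_add_C, mul_one]
  exact (Polynomial.natDegree_map_le).trans h1

/-! ### The difference and differential equations of `exp_# (-f_α^↑)` -/

/-- The Taylor coefficients of `f_α`. -/
noncomputable def logCoeff (α : ℂ) (k : ℕ) : ℂ := -α * (-α) ^ k / k

/-- Division by zero gives the correct value here, as `f_α(0) = 0`. -/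
theorem logCoeff_zero (α : ℂ) : logCoeff α 0 = 0 := by simp [logCoeff]

theorem logCoeff_one (α : ℂ) : logCoeff α 1 = α ^ 2 := by simp [logCoeff]; ring

theorem logCoeff_succ (α : ℂ) (k : ℕ) : ((k : ℂ) + 1) * logCoeff α (k + 1) = α ^ 2 * (-α) ^ k := by
  have := Nat.cast_add_one_ne_zero (R := ℂ) k
  rw [logCoeff]
  push_cast
  field_simp
  ring

section ShiftedSeries

variable {R : Type*} [CommRing R] [Algebra ℂ R] (α : ℂ)

/-- `f_α^↑ (n, τ + z)` as a power series in `t = n⁻¹`. -/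
noncomputable def upSer (z : R) : PowerSeries R[X] :=
  PowerSeries.mk fun k => Polynomial.C (algebraMap ℂ R (logCoeff α k)) *
    Polynomial.aeval (Polynomial.X + Polynomial.C z) (betaStar k)

/-- The quadratic part `α² τ² t / 2` of `f_α^↑`. -/
noncomputable def quadSer (R : Type*) [CommRing R] [Algebra ℂ R] (α : ℂ) : PowerSeries R[X] :=
  PowerSeries.X * PowerSeries.C (Polynomial.C (algebraMap ℂ R (α ^ 2 / 2)) * Polynomial.X ^ 2)

/-- `exp (α² τ² t / 2 - f_α^↑ (n, τ + z))` as a power series in `t = n⁻¹`. -/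
noncomputable def shiftExp (z : R) : PowerSeries R[X] := expS (quadSer R α - upSer α z)

theorem coeff_zero_upSer (z : R) : PowerSeries.coeff 0 (upSer α z) = 0 := by
  rw [upSer, PowerSeries.coeff_mk, logCoeff_zero, map_zero, Polynomial.C_0, zero_mul]

theorem coeff_quadSer (N : ℕ) : PowerSeries.coeff N (quadSer R α) =
    if N = 1 then Polynomial.C (algebraMap ℂ R (α ^ 2 / 2)) * Polynomial.X ^ 2 else 0 := by
  rw [quadSer, mul_comm, PowerSeries.coeff_C_mul, PowerSeries.coeff_X]
  split_ifs <;> simp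

theorem coeff_zero_quadSer_sub (z : R) :
    PowerSeries.coeff 0 (quadSer R α - upSer α z) = 0 := by
  rw [map_sub, coeff_zero_upSer, coeff_quadSer]
  simp

theorem aeval_betaStar_one (z : R) :
    Polynomial.aeval (Polynomial.X + Polynomial.C z) (betaStar 1) =
      Polynomial.C (algebraMap ℂ R (1 / 2)) * (Polynomial.X + Polynomial.C z) ^ 2 -
        Polynomial.C (algebraMap ℂ R (1 / 24)) := by
  rw [betaStar_one]
  simp only [map_sub, map_mul, map_pow, Polynomial.aeval_X, Polynomial.aeval_C,
    Polynomial.algebraMap_apply]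

/-- At `t` the quadratic terms in `τ` cancel and the degree is at most `1`; at `t^N` with `N ≥ 2`
the degree is at most `N + 1 ≤ 3N/2`. -/
theorem growth_quadSer_sub (z : R) : Growth 0 (quadSer R α - upSer α z) := by
  intro N
  rw [map_sub, coeff_quadSer, upSer, PowerSeries.coeff_mk]
  split_ifs with h
  · subst h
    rw [logCoeff_one, aeval_betaStar_one]
    have e : Polynomial.C (algebraMap ℂ R (α ^ 2 / 2)) * Polynomial.X ^ 2 -
        Polynomial.C (algebraMap ℂ R (α ^ 2)) * (Polynomial.C (algebraMap ℂ R (1 / 2)) *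
          (Polynomial.X + Polynomial.C z) ^ 2 - Polynomial.C (algebraMap ℂ R (1 / 24))) =
        Polynomial.C (-(algebraMap ℂ R (α ^ 2) * z)) * Polynomial.X +
        Polynomial.C (algebraMap ℂ R (α ^ 2 / 24) - algebraMap ℂ R (α ^ 2 / 2) * z ^ 2) := by
      have e1 : algebraMap ℂ R (α ^ 2 / 2) = algebraMap ℂ R (α ^ 2) * algebraMap ℂ R (1 / 2) := by
        rw [← map_mul]; congr 1; ring
      have e2 : algebraMap ℂ R (α ^ 2 / 24) =
          algebraMap ℂ R (α ^ 2) * algebraMap ℂ R (1 / 24) := by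
        rw [← map_mul]; congr 1; ring
      have e3 : (Polynomial.C (algebraMap ℂ R (1 / 2)) : R[X]) * 2 = 1 := by
        rw [show (2 : R[X]) = Polynomial.C (algebraMap ℂ R 2) by rw [map_ofNat, map_ofNat],
          ← Polynomial.C_mul,
          ← map_mul]
        norm_num
      simp only [e1, e2, Polynomial.C_neg, Polynomial.C_sub, Polynomial.C_mul, Polynomial.C_pow]
      linear_combination (-(Polynomial.C (algebraMap ℂ R (α ^ 2)) * Polynomial.C z *
        Polynomial.X)) * e3
    rw [e]
    have := Polynomial.natDegree_linear_le (a := -(algebraMap ℂ R (α ^ 2) * z))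
      (b := algebraMap ℂ R (α ^ 2 / 24) - algebraMap ℂ R (α ^ 2 / 2) * z ^ 2)
    omega
  · rw [zero_sub, Polynomial.natDegree_neg]
    rcases Nat.eq_zero_or_pos N with rfl | hN
    · simp [logCoeff_zero]
    · have h1 : (Polynomial.aeval (Polynomial.X + Polynomial.C z) (betaStar N)).natDegree ≤
          N + 1 := by
        rw [← Polynomial.eval_map_algebraMap, Polynomial.eval_eq_sum_range]
        refine Polynomial.natDegree_sum_le_of_forall_le _ _ fun i hi => ?_
        rw [Polynomial.coeff_map, Polynomial.algebraMap_apply]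
        refine (Polynomial.natDegree_C_mul_le _ _).trans ?_
        have h0 : (Polynomial.X + Polynomial.C z).natDegree ≤ 1 := by
          rw [Polynomial.natDegree_add_C]
          exact Polynomial.natDegree_X_le
        refine (Polynomial.natDegree_pow_le_of_le i h0).trans ?_
        have := Finset.mem_range_succ_iff.mp hi
        have h2 : ((betaStar N).map (algebraMap ℂ R[X])).natDegree ≤ (betaStar N).natDegree :=
          Polynomial.natDegree_map_le
        have h3 := natDegree_betaStar_le N
        omega
      have h2 := Polynomial.natDegree_C_mul_le (algebraMap ℂ R (logCoeff α N))
        (Polynomial.aeval (Polynomial.X + Polynomial.C z) (betaStar N))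
      omega

theorem growth_shiftExp (z : R) : Growth 0 (shiftExp α z) := (growth_quadSer_sub α z).expS

theorem derivTau_algebraMap_mul (c : ℂ) (p : R[X]) :
    derivTau (Polynomial.C (algebraMap ℂ R c) * p) =
      Polynomial.C (algebraMap ℂ R c) * derivTau p := by
  rw [derivTau_apply, derivTau_apply, Polynomial.derivative_C_mul]

/-- Coefficientwise this is `(1 + αx) f_α' = α²` combined with `(β*_{k+1})' = (k+1) β*_k`. Only the
constant `α²` survives, carried by `β*_0(τ) = τ`. -/
theorem upSer_pde (z : R) :
    PowerSeries.X * (PowerSeries.C (Polynomial.C (algebraMap ℂ R α)) *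
      gradDer 0 1 (upSer α z)) + gradDer derivTau 0 (upSer α z) =
    PowerSeries.X * PowerSeries.C (Polynomial.C (algebraMap ℂ R (α ^ 2)) *
      (Polynomial.X + Polynomial.C z)) := by
  have hd : ∀ k : ℕ, PowerSeries.coeff (k + 1) (gradDer derivTau 0 (upSer α z)) =
      Polynomial.C (algebraMap ℂ R (α ^ 2 * (-α) ^ k)) *
        Polynomial.aeval (Polynomial.X + Polynomial.C z) (betaStar k) := by
    intro k
    rw [coeff_gradDer, upSer, PowerSeries.coeff_mk, derivTau_algebraMap_mul,
      Derivation.map_aeval, derivTau_apply, derivative_betaStar, ← logCoeff_succ]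
    simp
    ring
  ext1 N
  rcases N with _ | _ | k
  · rw [map_add, PowerSeries.coeff_zero_X_mul, PowerSeries.coeff_zero_X_mul, coeff_gradDer,
      coeff_zero_upSer]
    simp
  · rw [map_add, hd, PowerSeries.coeff_succ_X_mul, PowerSeries.coeff_succ_X_mul,
      PowerSeries.coeff_C_mul, coeff_gradDer, coeff_zero_upSer, PowerSeries.coeff_C, betaStar_zero]
    simp
  · rw [map_add, hd, PowerSeries.coeff_succ_X_mul, PowerSeries.coeff_succ_X_mul,
      PowerSeries.coeff_C_mul, coeff_gradDer, upSer, PowerSeries.coeff_mk, PowerSeries.coeff_C]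
    simp only [Derivation.zero_apply, zero_add, one_mul, Nat.succ_ne_zero, if_false,
      Polynomial.algebraMap_apply]
    rw [← mul_assoc, ← mul_assoc, ← Polynomial.C_mul, ← Polynomial.C_mul, ← map_mul, ← map_mul,
      ← add_mul, ← Polynomial.C_add, ← map_add]
    have : α * ((k + 1 : ℕ) : ℂ) * logCoeff α (k + 1) + α ^ 2 * (-α) ^ (k + 1) = 0 := by
      have := logCoeff_succ α k
      push_cast
      linear_combination α * this
    rw [this]
    simp

theorem gradDer_derivTau_quadSer : gradDer derivTau 0 (quadSer R α) =
    PowerSeries.X * PowerSeries.C (Polynomial.C (algebraMap ℂ R (α ^ 2)) * Polynomial.X) := by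
  rw [quadSer, gradDer_mul, gradDer_X, gradDer_C, derivTau_algebraMap_mul, derivTau_apply]
  have : algebraMap ℂ R (α ^ 2) = algebraMap ℂ R (α ^ 2 / 2) * 2 := by
    rw [show (2 : R) = algebraMap ℂ R 2 by rw [map_ofNat], ← map_mul]
    congr 1
    ring
  rw [this]
  simp only [map_zero, zero_mul, zero_add, Polynomial.derivative_X_pow]
  congr 2
  simp
  ring

theorem gradDer_euler_quadSer : gradDer 0 1 (quadSer R α) = quadSer R α := by
  rw [quadSer, gradDer_mul, gradDer_X, gradDer_C]
  simp

/-- At `z = 0` the right side of `upSer_pde` equals the `τ`-derivative of the quadratic part, so the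
two cancel. -/
theorem shiftExp_zero_pde :
    PowerSeries.X * (PowerSeries.C (Polynomial.C (algebraMap ℂ R α)) *
      (gradDer 0 1 (shiftExp α (0 : R)) - quadSer R α * shiftExp α (0 : R))) =
    -gradDer derivTau 0 (shiftExp α (0 : R)) := by
  rw [shiftExp, gradDer_expS _ _ (coeff_zero_quadSer_sub α 0),
    gradDer_expS _ _ (coeff_zero_quadSer_sub α 0), gradDer_sub, gradDer_sub,
    gradDer_euler_quadSer, gradDer_derivTau_quadSer]
  have h := upSer_pde α (0 : R)
  rw [Polynomial.C_0, add_zero] at h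
  linear_combination (-expS (quadSer R α - upSer α 0)) * h

end ShiftedSeries

/-! ### Translation invariance and the difference equation -/

/-- Differentiation of the coefficients of a polynomial in `τ` over `ℂ[c]` with respect
to `c`. -/
noncomputable def derivCoeff : Derivation ℂ ℂ[X][X] ℂ[X][X] :=
  ((PolynomialModule.equivPolynomialSelf (R := ℂ[X])).toLinearMap).compDer
    (Polynomial.derivative' (R := ℂ)).mapCoeffs

theorem coeff_derivCoeff (p : ℂ[X][X]) (i : ℕ) :
    (derivCoeff p).coeff i = Polynomial.derivative (p.coeff i) := rfl

theorem derivCoeff_X : derivCoeff Polynomial.X = 0 := by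
  ext1 i
  rw [coeff_derivCoeff, Polynomial.coeff_X]
  split_ifs <;> simp

theorem derivCoeff_C (p : ℂ[X]) :
    derivCoeff (Polynomial.C p) = Polynomial.C (Polynomial.derivative p) := by
  ext1 i
  rw [coeff_derivCoeff, Polynomial.coeff_C, Polynomial.coeff_C]
  split_ifs <;> simp

theorem derivCoeff_algebraMap_mul (c : ℂ) (p : ℂ[X][X]) :
    derivCoeff (Polynomial.C (algebraMap ℂ ℂ[X] c) * p) =
      Polynomial.C (algebraMap ℂ ℂ[X] c) * derivCoeff p := by
  rw [Derivation.leibniz, derivCoeff_C]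
  simp

theorem gradDer_derivCoeff_upSer (α : ℂ) :
    gradDer derivCoeff 0 (upSer α (Polynomial.X : ℂ[X])) =
      gradDer derivTau 0 (upSer α (Polynomial.X : ℂ[X])) := by
  ext1 N
  rw [coeff_gradDer, coeff_gradDer, upSer, PowerSeries.coeff_mk, derivCoeff_algebraMap_mul,
    derivTau_algebraMap_mul, Derivation.map_aeval, Derivation.map_aeval, map_add, map_add,
    derivCoeff_X, derivCoeff_C, derivTau_apply, derivTau_apply]
  simp

theorem gradDer_derivCoeff_quadSer (α : ℂ) : gradDer derivCoeff 0 (quadSer ℂ[X] α) = 0 := by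
  rw [quadSer, gradDer_mul, gradDer_X, gradDer_C, derivCoeff_algebraMap_mul,
    Derivation.leibniz_pow, derivCoeff_X]
  simp

theorem gaussInt_derivCoeff {μ : ℕ → ℂ} (x : PowerSeries ℂ[X][X]) (m : ℕ) :
    gaussInt μ (gradDer derivCoeff 0 x) m = Polynomial.derivative (gaussInt μ x m) := by
  rw [gaussInt, gaussInt, Polynomial.derivative_sum]
  refine Finset.sum_congr rfl fun r _ => ?_
  rw [coeff_gradDer]
  simp [coeff_derivCoeff]

theorem map_shiftExp {R R' : Type*} [CommRing R] [Algebra ℂ R] [CommRing R'] [Algebra ℂ R']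
    (φ : R →ₐ[ℂ] R') (α : ℂ) (z : R) :
    (shiftExp α z).map (Polynomial.mapRingHom (φ : R →+* R')) = shiftExp α (φ z) := by
  have h := map_expS (Polynomial.mapAlgHom φ) (quadSer R α - upSer α z)
  have e : ((Polynomial.mapAlgHom φ : R[X] →ₐ[ℂ] R'[X]) : R[X] →+* R'[X]) =
      Polynomial.mapRingHom (φ : R →+* R') := rfl
  rw [e] at h
  rw [shiftExp, h, shiftExp]
  congr 1
  ext1 N
  have e2 : Polynomial.map (φ : R →+* R') (Polynomial.aeval (Polynomial.X + Polynomial.C z)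
      (betaStar N)) = Polynomial.aeval (Polynomial.X + Polynomial.C (φ z)) (betaStar N) := by
    have := Polynomial.aeval_algHom_apply (Polynomial.mapAlgHom φ)
      (Polynomial.X + Polynomial.C z) (betaStar N)
    rw [map_add] at this
    simpa using this.symm
  rw [PowerSeries.coeff_map, map_sub, map_sub, map_sub, coeff_quadSer, coeff_quadSer, upSer,
    upSer, PowerSeries.coeff_mk, PowerSeries.coeff_mk, map_mul, Polynomial.coe_mapRingHom, e2]
  congr 1
  · split_ifs <;> simp
  · simp

/-- Take the shift to be an indeterminate `c`. Since `f_α^↑(n, τ + c)` has equal derivatives in `c`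
and `τ`, the `c`-derivative of the integral is the integral of a total `τ`-derivative, hence zero.
The integral is thus a constant polynomial in `c`, to be evaluated at any `z`. -/
theorem gaussInt_shiftExp {α : ℂ} {μ : ℕ → ℂ}
    (hμ : ∀ r, α ^ 2 * μ (r + 1) = (2 * r + 1) * μ r) (z : ℂ) (m : ℕ) :
    gaussInt μ (shiftExp α z) m = gaussInt μ (shiftExp α (0 : ℂ)) m := by
  have hd : Polynomial.derivative (gaussInt μ (shiftExp α (Polynomial.X : ℂ[X])) m) = 0 := by
    rw [← gaussInt_derivCoeff, ← gaussInt_integration_by_parts hμ (growth_shiftExp α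
      (Polynomial.X : ℂ[X])) m]
    congr 1
    rw [shiftExp, gradDer_expS _ _ (coeff_zero_quadSer_sub α _),
      gradDer_expS _ _ (coeff_zero_quadSer_sub α _), gradDer_sub, gradDer_sub,
      gradDer_derivCoeff_upSer, gradDer_derivCoeff_quadSer, gradDer_derivTau_quadSer]
    ring
  have hc := Polynomial.derivative_eq_zero.mp hd
  rw [Polynomial.natDegree_eq_zero] at hc
  obtain ⟨c, hc⟩ := hc
  have hev : ∀ y : ℂ, gaussInt μ (shiftExp α y) m = c := by
    intro y
    have h1 := gaussInt_map (μ := μ) (Polynomial.aeval y : ℂ[X] →ₐ[ℂ] ℂ)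
      (shiftExp α (Polynomial.X : ℂ[X])) m
    rw [map_shiftExp, Polynomial.aeval_X, ← hc, Polynomial.aeval_C] at h1
    exact h1
  rw [hev, hev]

/-- On exponents: `f_α^↑(n,τ) - f_α^↑(n,τ-1) = α log(1 + α(τ - 1/2)t)`, by `betaStar_sub_comp`. -/
theorem binomSer_mul_shiftExp (α : ℂ) :
    binomSer (Polynomial.C α * (Polynomial.X - Polynomial.C (1 / 2))) α * shiftExp α (0 : ℂ) =
      shiftExp α (-1 : ℂ) := by
  rw [binomSer_eq_expS, shiftExp, shiftExp,
    ← expS_add (coeff_zero_logSer _ _) (coeff_zero_quadSer_sub α _)]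
  congr 1
  have : logSer (Polynomial.C α * (Polynomial.X - Polynomial.C (1 / 2))) α =
      upSer α (0 : ℂ) - upSer α (-1 : ℂ) := by
    ext1 N
    have e := betaStar_sub_comp N
    rw [Polynomial.comp_eq_aeval] at e
    rw [map_sub, logSer, upSer, upSer, PowerSeries.coeff_mk, PowerSeries.coeff_mk,
      PowerSeries.coeff_mk, ← mul_sub, Polynomial.C_0, add_zero, Polynomial.C_neg,
      Polynomial.C_1, ← sub_eq_add_neg, Polynomial.aeval_X_left_apply, e, mul_pow, ← mul_assoc,
      Polynomial.algebraMap_apply, ← Polynomial.C_pow, ← Polynomial.C_mul]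
    congr 2
    simp only [Algebra.algebraMap_self, RingHom.id_apply]
    rw [logCoeff, neg_pow α N]
    ring
  rw [this]
  ring

/-! ### Moments of `(1 + α (τ - 1/2) t) ^ j` and the integro-differential equation -/

/-- `α (τ - 1/2)`. -/
noncomputable def stepPoly (α : ℂ) : ℂ[X] :=
  Polynomial.C α * (Polynomial.X - Polynomial.C (1 / 2))

/-- `1 + α (τ - 1/2) t`. -/
noncomputable def stepSer (α : ℂ) : PowerSeries ℂ[X] :=
  1 + PowerSeries.C (stepPoly α) * PowerSeries.X

theorem natDegree_stepPoly_le (α : ℂ) : (stepPoly α).natDegree ≤ 1 :=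
  (Polynomial.natDegree_C_mul_le _ _).trans (by rw [Polynomial.natDegree_X_sub_C])

theorem growth_stepSer (α : ℂ) : Growth 0 (stepSer α) :=
  growth_one.add (growth_C_mul_X (by have := natDegree_stepPoly_le α; omega))

theorem growth_stepSer_pow_mul (α : ℂ) (j : ℕ) :
    Growth 0 (stepSer α ^ j * shiftExp α (0 : ℂ)) :=
  ((growth_stepSer α).pow j).mul (growth_shiftExp α 0)

/-- The moments `∫ (1 + α (τ - 1/2) t) ^ j exp_# (-f_α^↑) dτ`. -/
noncomputable def stepMoment (μ : ℕ → ℂ) (α : ℂ) (j m : ℕ) : ℂ :=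
  gaussInt μ (stepSer α ^ j * shiftExp α (0 : ℂ)) m

theorem stepSer_pow_pde (α : ℂ) (j : ℕ) :
    PowerSeries.X * (PowerSeries.C (Polynomial.C α) * gradDer 0 1 (stepSer α ^ j)) +
      gradDer derivTau 0 (stepSer α ^ j) =
    PowerSeries.X * (PowerSeries.C (Polynomial.C (j * α)) * stepSer α ^ j) := by
  cases j with
  | zero =>
    have h : ∀ (δ : Derivation ℂ ℂ[X] ℂ[X]) (c : ℂ), gradDer δ c (1 : PowerSeries ℂ[X]) = 0 := by
      intro δ c
      rw [← map_one (PowerSeries.C (R := ℂ[X])), gradDer_C]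
      simp
    simp [h]
  | succ j =>
    have h1 : ∀ (δ : Derivation ℂ ℂ[X] ℂ[X]) (c : ℂ), gradDer δ c (1 : PowerSeries ℂ[X]) = 0 := by
      intro δ c
      rw [← map_one (PowerSeries.C (R := ℂ[X])), gradDer_C]
      simp
    have h2 : gradDer 0 1 (stepSer α) = PowerSeries.C (stepPoly α) * PowerSeries.X := by
      rw [stepSer, gradDer_add, h1, gradDer_mul, gradDer_C, gradDer_X]
      simp
    have h3 : gradDer derivTau 0 (stepSer α) =
        PowerSeries.C (Polynomial.C α) * PowerSeries.X := by
      rw [stepSer, gradDer_add, h1, gradDer_mul, gradDer_C, gradDer_X, derivTau_apply, stepPoly]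
      simp
    rw [gradDer_pow_succ, gradDer_pow_succ, h2, h3]
    have h4 : PowerSeries.C (stepPoly α) * PowerSeries.X = stepSer α - 1 := by
      rw [stepSer]; ring
    rw [h4]
    simp only [Nat.cast_add, Nat.cast_one, map_mul, map_add, map_one, map_natCast]
    ring

/-- The equations of `stepSer α ^ j` and `shiftExp α 0` are added by the product rule. The factor
`α² τ t` needed to complete the total `τ`-derivative equals `α (u - 1) + α² t / 2` with `u = stepSer
α`, which brings in `u^(j+1)`. -/
theorem stepMoment_identity (α : ℂ) (j : ℕ) :
    PowerSeries.X * (PowerSeries.C (Polynomial.C α) *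
      (gradDer 0 1 (stepSer α ^ j * shiftExp α (0 : ℂ)) - PowerSeries.X * (PowerSeries.C
      (Polynomial.C (algebraMap ℂ ℂ (α ^ 2 / 2)) * Polynomial.X ^ 2) *
        (stepSer α ^ j * shiftExp α (0 : ℂ))))) =
    PowerSeries.X * (PowerSeries.C (Polynomial.C (j * α - α ^ 2 / 2)) *
      (stepSer α ^ j * shiftExp α (0 : ℂ))) -
    (gradDer derivTau 0 (stepSer α ^ j * shiftExp α (0 : ℂ)) -
      PowerSeries.X * (PowerSeries.C (Polynomial.C (algebraMap ℂ ℂ (α ^ 2)) * Polynomial.X) *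
        (stepSer α ^ j * shiftExp α (0 : ℂ)))) -
    PowerSeries.C (Polynomial.C α) * (stepSer α ^ (j + 1) * shiftExp α (0 : ℂ)) +
    PowerSeries.C (Polynomial.C α) * (stepSer α ^ j * shiftExp α (0 : ℂ)) := by
  have h1 := stepSer_pow_pde α j
  have h2 := shiftExp_zero_pde (R := ℂ) α
  have h3 : PowerSeries.X * PowerSeries.C (Polynomial.C (α ^ 2) * Polynomial.X) =
      PowerSeries.C (Polynomial.C α) * (stepSer α - 1) +
        PowerSeries.X * PowerSeries.C (Polynomial.C (α ^ 2 / 2)) := by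
    rw [stepSer, add_sub_cancel_left, stepPoly, mul_comm (PowerSeries.C _) PowerSeries.X,
      mul_left_comm, ← mul_add, ← map_mul, ← map_add]
    congr 2
    have : (Polynomial.C (α ^ 2 / 2) : ℂ[X]) =
        Polynomial.C α * (Polynomial.C α * Polynomial.C (1 / 2)) := by
      rw [← Polynomial.C_mul, ← Polynomial.C_mul]; congr 1; ring
    rw [this, Polynomial.C_pow]
    ring
  rw [quadSer] at h2
  simp only [Algebra.algebraMap_self, RingHom.id_apply] at h2 ⊢
  rw [gradDer_mul, gradDer_mul]
  rw [show (Polynomial.C (j * α - α ^ 2 / 2) : ℂ[X]) = Polynomial.C (j * α) -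
    Polynomial.C (α ^ 2 / 2) from Polynomial.C_sub, map_sub (PowerSeries.C (R := ℂ[X]))]
  linear_combination (shiftExp α (0 : ℂ)) * h1 + stepSer α ^ j * h2 -
    (stepSer α ^ j * shiftExp α (0 : ℂ)) * h3

section Moments

variable {α : ℂ} {μ : ℕ → ℂ}

theorem gaussInt_X_mul_C_mul {R : Type*} [CommRing R] [Algebra ℂ R] (z : R)
    (x : PowerSeries R[X]) (m : ℕ) :
    gaussInt μ (PowerSeries.X * (PowerSeries.C (Polynomial.C z) * x)) m =
      z * gaussInt μ (PowerSeries.X * x) m := by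
  rw [mul_left_comm, gaussInt_C_mul]

/-- The factor `t τ²` has growth `1` but not `0`; this is why the cutoff in `gaussInt` must
accommodate `Growth 1`. -/
theorem growth_euler_stepSer_pow_mul (α : ℂ) (j : ℕ) :
    Growth 1 (gradDer 0 1 (stepSer α ^ j * shiftExp α (0 : ℂ)) - PowerSeries.X * (PowerSeries.C
      (Polynomial.C (algebraMap ℂ ℂ (α ^ 2 / 2)) * Polynomial.X ^ 2) *
        (stepSer α ^ j * shiftExp α (0 : ℂ)))) := by
  refine Growth.sub ?_ ?_
  · intro N
    rw [coeff_gradDer, Derivation.zero_apply, zero_add, Polynomial.algebraMap_apply]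
    have h1 := growth_stepSer_pow_mul α j N
    have h2 := Polynomial.natDegree_C_mul_le (algebraMap ℂ ℂ (1 * N))
      (PowerSeries.coeff N (stepSer α ^ j * shiftExp α (0 : ℂ)))
    omega
  · rw [← mul_assoc, mul_comm PowerSeries.X]
    refine (growth_C_mul_X (K := 1) ?_).mul (growth_stepSer_pow_mul α j)
    have := Polynomial.natDegree_C_mul_X_pow_le (algebraMap ℂ ℂ (α ^ 2 / 2)) 2
    omega

theorem stepMoment_succ_succ (hα : α ≠ 0) (hμ : ∀ r, α ^ 2 * μ (r + 1) = (2 * r + 1) * μ r)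
    (j m : ℕ) : stepMoment μ α (j + 1) (m + 1) = stepMoment μ α j (m + 1) +
      (j - α / 2 - (m - 1 / 2)) * stepMoment μ α j m := by
  have h := congrArg (fun x => gaussInt μ x (m + 1)) (stepMoment_identity α j)
  have hg := growth_stepSer_pow_mul α j
  simp only [gaussInt_add, gaussInt_sub _ (PowerSeries.C _ * _), gaussInt_C_mul] at h
  rw [gaussInt_sub (_ * _) (_ - _), gaussInt_integration_by_parts hμ hg,
    gaussInt_X_mul_C_mul, gaussInt_X_mul_C_mul,
    gaussInt_X_mul_succ (growth_euler_stepSer_pow_mul α j), gaussInt_euler hμ hg,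
    gaussInt_X_mul_succ (hg.mono zero_le_one)] at h
  simp only [Algebra.algebraMap_self, RingHom.id_apply] at h
  apply mul_left_cancel₀ hα
  simp only [stepMoment]
  linear_combination h

theorem stepMoment_succ_zero (hα : α ≠ 0) (hμ : ∀ r, α ^ 2 * μ (r + 1) = (2 * r + 1) * μ r)
    (j : ℕ) : stepMoment μ α (j + 1) 0 = stepMoment μ α j 0 := by
  have h := congrArg (fun x => gaussInt μ x 0) (stepMoment_identity α j)
  have hg := growth_stepSer_pow_mul α j
  simp only [gaussInt_add, gaussInt_sub _ (PowerSeries.C _ * _), gaussInt_C_mul] at h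
  rw [gaussInt_sub (_ * _) (_ - _), gaussInt_integration_by_parts hμ hg,
    gaussInt_X_mul_C_mul, gaussInt_X_mul_C_mul,
    gaussInt_X_mul_zero (growth_euler_stepSer_pow_mul α j),
    gaussInt_X_mul_zero (hg.mono zero_le_one)] at h
  apply mul_left_cancel₀ hα
  simp only [stepMoment]
  linear_combination h

/-! ### The operators `-n` and `t∂_t + α/2` acting on the moments -/

/-- The moments, extended by `0` to negative indices. -/
noncomputable def stepMomentInt (μ : ℕ → ℂ) (α : ℂ) (j : ℕ) (n : ℤ) : ℂ :=
  if 0 ≤ n then stepMoment μ α j n.toNat else 0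

theorem stepMomentInt_natCast (j n : ℕ) : stepMomentInt μ α j n = stepMoment μ α j n := by
  simp [stepMomentInt]

theorem stepMomentInt_of_neg (j : ℕ) {n : ℤ} (hn : n < 0) : stepMomentInt μ α j n = 0 := by
  simp [stepMomentInt, not_le.mpr hn]

theorem stepMomentInt_succ (hα : α ≠ 0) (hμ : ∀ r, α ^ 2 * μ (r + 1) = (2 * r + 1) * μ r)
    (j : ℕ) (n : ℤ) : stepMomentInt μ α (j + 1) (n + 1) = stepMomentInt μ α j (n + 1) +
      (j - α / 2 - (n - 1 / 2)) * stepMomentInt μ α j n := by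
  rcases lt_trichotomy n (-1) with h | h | h
  · rw [stepMomentInt_of_neg _ (by omega), stepMomentInt_of_neg _ (by omega),
      stepMomentInt_of_neg _ (by omega)]
    ring
  · subst h
    rw [stepMomentInt_of_neg (n := -1) _ (by omega), show (-1 : ℤ) + 1 = (0 : ℕ) by simp,
      stepMomentInt_natCast, stepMomentInt_natCast, stepMoment_succ_zero hα hμ]
    ring
  · obtain ⟨m, rfl⟩ := Int.eq_ofNat_of_zero_le (show 0 ≤ n by omega)
    rw [show (m : ℤ) + 1 = ((m + 1 : ℕ) : ℤ) by simp, stepMomentInt_natCast,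
      stepMomentInt_natCast, stepMomentInt_natCast, stepMoment_succ_succ hα hμ]
    simp

/-- Multiplication by `-n = -t⁻¹` on sequences of coefficients. -/
noncomputable def shiftOp : Module.End ℂ (ℤ → ℂ) where
  toFun x := fun m => -x (m + 1)
  map_add' x y := by funext m; simp [add_comm]
  map_smul' c x := by funext m; simp

/-- The operator `t ∂_t + α / 2` on series in `t ^ (m - 1/2)`. -/
noncomputable def thetaOp (α : ℂ) : Module.End ℂ (ℤ → ℂ) where
  toFun x := fun m => ((m : ℂ) - 1 / 2 + α / 2) * x m
  map_add' x y := by funext m; simp [mul_add]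
  map_smul' c x := by funext m; simp; ring

theorem shiftOp_pow_apply (i : ℕ) (x : ℤ → ℂ) (m : ℤ) :
    (shiftOp ^ i) x m = (-1) ^ i * x (m + i) := by
  induction i generalizing m with
  | zero => simp
  | succ i ih =>
    rw [pow_succ', Module.End.mul_apply]
    change -((shiftOp ^ i) x (m + 1)) = _
    rw [ih, pow_succ]
    push_cast
    rw [add_right_comm, add_assoc]
    ring

theorem shiftOp_commutator (α : ℂ) :
    shiftOp * thetaOp α - thetaOp α * shiftOp = shiftOp := by
  ext x m
  change -((((m + 1 : ℤ) : ℂ) - 1 / 2 + α / 2) * x (m + 1)) -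
    ((m : ℂ) - 1 / 2 + α / 2) * -x (m + 1) = -x (m + 1)
  push_cast
  ring

theorem shiftOp_add_thetaOp_pow (hα : α ≠ 0)
    (hμ : ∀ r, α ^ 2 * μ (r + 1) = (2 * r + 1) * μ r) (j : ℕ) (m : ℤ) :
    ((shiftOp + thetaOp α) ^ j) (stepMomentInt μ α 0) m =
      (-1) ^ j * stepMomentInt μ α j (m + j) := by
  induction j generalizing m with
  | zero => simp
  | succ j ih =>
    rw [pow_succ', Module.End.mul_apply]
    change -(((shiftOp + thetaOp α) ^ j) (stepMomentInt μ α 0) (m + 1)) +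
      ((m : ℂ) - 1 / 2 + α / 2) * ((shiftOp + thetaOp α) ^ j) (stepMomentInt μ α 0) m = _
    rw [ih, ih, show m + ((j + 1 : ℕ) : ℤ) = m + j + 1 by push_cast; ring,
      stepMomentInt_succ hα hμ, pow_succ, add_right_comm m 1]
    push_cast
    ring

/-- Apply `add_pow_eq_sum_evalS` to `shiftOp` and `thetaOp α` and read the coefficient of index `M -
a`, where `D + (a-k)/2` acts as the scalar `M - 1/2 + (α-a)/2 - k/2`. -/
theorem stepMoment_eq_sum_range (hα : α ≠ 0)
    (hμ : ∀ r, α ^ 2 * μ (r + 1) = (2 * r + 1) * μ r) (a M : ℕ) :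
    stepMoment μ α a M = ∑ k ∈ Finset.range (a + 1),
      (-1) ^ k * evalS k ((M : ℂ) - 1 / 2 + (α - a) / 2 - k / 2) ((a : ℂ) - k) *
        stepMomentInt μ α 0 (M - k) := by
  have h1 := shiftOp_add_thetaOp_pow hα hμ a ((M : ℤ) - a)
  rw [sub_add_cancel, stepMomentInt_natCast, add_pow_eq_sum_evalS (shiftOp_commutator α),
    LinearMap.sum_apply, Finset.sum_apply] at h1
  have h2 : ((-1 : ℂ) ^ a) * (-1) ^ a = 1 := by rw [← mul_pow]; simp
  have h0 : stepMoment μ α a M = (-1) ^ a * ((-1) ^ a * stepMoment μ α a M) := by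
    rw [← mul_assoc, h2, one_mul]
  rw [h0, ← h1, Finset.mul_sum]
  refine Finset.sum_congr rfl fun k hk => ?_
  obtain ⟨b, rfl⟩ := Nat.exists_eq_add_of_le (Finset.mem_range_succ_iff.mp hk)
  rw [Module.End.mul_apply, evalS_eq_aeval,
    aeval_diagonal_apply (v := fun m : ℤ => (m : ℂ) - 1 / 2 + α / 2) (fun _ _ => rfl),
    shiftOp_pow_apply, evalS_scalar, Nat.add_sub_cancel_left]
  have h3 : (M : ℤ) - ((k + b : ℕ) : ℤ) + b = M - k := by push_cast; ring
  have h4 : ((-1 : ℂ) ^ (k + b)) * (-1) ^ b = (-1) ^ k := by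
    rw [pow_add, mul_assoc, ← mul_pow]; simp
  rw [h3]
  have h5 : (((M : ℤ) - ((k + b : ℕ) : ℤ) : ℤ) : ℂ) - 1 / 2 + α / 2 +
      (((k + b : ℕ) : ℂ) - k) / 2 = (M : ℂ) - 1 / 2 + (α - ((k + b : ℕ) : ℂ)) / 2 - k / 2 := by
    push_cast
    ring
  rw [h5]
  linear_combination (stepMomentInt μ α 0 (M - k) * Polynomial.eval
    ((M : ℂ) - 1 / 2 + (α - ((k + b : ℕ) : ℂ)) / 2 - k / 2) (SPoly k (((k + b : ℕ) : ℂ) - k))) * h4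

theorem SPoly_natCast_sub_eq_zero {a k : ℕ} (h : a < k) : SPoly k ((a : ℂ) - k) = 0 := by
  rw [SPoly_eq, Finset.prod_eq_zero (i := k - a), Polynomial.C_0, zero_mul]
  · rw [Finset.mem_Icc]; omega
  · rw [Nat.cast_sub h.le]; ring

/-- The range of summation no longer depends on `a`: terms with `k > a` vanish through the factor `i
= k - a` of the product in `S_k`, those with `k > M` because the moment has negative index. This
permits interpolation in `a`. -/
theorem stepMoment_eq_sum (hα : α ≠ 0)
    (hμ : ∀ r, α ^ 2 * μ (r + 1) = (2 * r + 1) * μ r) (a M : ℕ) :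
    stepMoment μ α a M = ∑ k ∈ Finset.range (M + 1),
      (-1) ^ k * evalS k ((M : ℂ) - 1 / 2 + (α - a) / 2 - k / 2) ((a : ℂ) - k) *
        stepMoment μ α 0 (M - k) := by
  rw [stepMoment_eq_sum_range hα hμ]
  have h1 : ∀ k ∈ Finset.range (M + 1), (-1) ^ k *
      evalS k ((M : ℂ) - 1 / 2 + (α - a) / 2 - k / 2) ((a : ℂ) - k) *
        stepMoment μ α 0 (M - k) = (-1) ^ k *
      evalS k ((M : ℂ) - 1 / 2 + (α - a) / 2 - k / 2) ((a : ℂ) - k) *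
        stepMomentInt μ α 0 (M - k) := by
    intro k hk
    rw [← stepMomentInt_natCast, Nat.cast_sub (Finset.mem_range_succ_iff.mp hk)]
  rw [Finset.sum_congr rfl h1]
  rcases le_total a M with h | h
  · refine Finset.sum_subset (Finset.range_mono (by omega)) fun k _ hk => ?_
    rw [evalS_scalar, SPoly_natCast_sub_eq_zero (by simpa using hk)]
    simp
  · refine (Finset.sum_subset (Finset.range_mono (by omega)) fun k _ hk => ?_).symm
    have : M < k := by simpa using hk
    rw [stepMomentInt_of_neg _ (by omega), mul_zero]

end Moments

/-! ### Interpolation from natural to complex exponents -/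

/-- `f` is a polynomial function. -/
def IsPolyFun (f : ℂ → ℂ) : Prop := ∃ p : ℂ[X], ∀ z, f z = p.eval z

theorem isPolyFun_const (c : ℂ) : IsPolyFun fun _ => c := ⟨Polynomial.C c, fun _ => by simp⟩

theorem isPolyFun_eval (p : ℂ[X]) : IsPolyFun fun z => p.eval z := ⟨p, fun _ => rfl⟩

theorem IsPolyFun.add {f g : ℂ → ℂ} (hf : IsPolyFun f) (hg : IsPolyFun g) :
    IsPolyFun fun z => f z + g z := by
  obtain ⟨p, hp⟩ := hf
  obtain ⟨q, hq⟩ := hg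
  exact ⟨p + q, fun z => by simp [hp, hq]⟩

theorem IsPolyFun.mul {f g : ℂ → ℂ} (hf : IsPolyFun f) (hg : IsPolyFun g) :
    IsPolyFun fun z => f z * g z := by
  obtain ⟨p, hp⟩ := hf
  obtain ⟨q, hq⟩ := hg
  exact ⟨p * q, fun z => by simp [hp, hq]⟩

theorem IsPolyFun.pow {f : ℂ → ℂ} (hf : IsPolyFun f) (n : ℕ) : IsPolyFun fun z => f z ^ n := by
  obtain ⟨p, hp⟩ := hf
  exact ⟨p ^ n, fun z => by simp [hp]⟩

theorem isPolyFun_sum {ι : Type*} (s : Finset ι) {f : ι → ℂ → ℂ} (hf : ∀ i ∈ s, IsPolyFun (f i)) :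
    IsPolyFun fun z => ∑ i ∈ s, f i z := by
  choose! p hp using hf
  refine ⟨∑ i ∈ s, p i, fun z => ?_⟩
  rw [Polynomial.eval_finsetSum]
  exact Finset.sum_congr rfl fun i hi => hp i hi z

theorem isPolyFun_prod {ι : Type*} (s : Finset ι) {f : ι → ℂ → ℂ}
    (hf : ∀ i ∈ s, IsPolyFun (f i)) : IsPolyFun fun z => ∏ i ∈ s, f i z := by
  choose! p hp using hf
  refine ⟨∏ i ∈ s, p i, fun z => ?_⟩
  rw [Polynomial.eval_prod]
  exact Finset.prod_congr rfl fun i hi => hp i hi z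

theorem IsPolyFun.eq_of_natCast {f g : ℂ → ℂ} (hf : IsPolyFun f) (hg : IsPolyFun g)
    (h : ∀ a : ℕ, f a = g a) : f = g := by
  obtain ⟨p, hp⟩ := hf
  obtain ⟨q, hq⟩ := hg
  have : p = q := by
    refine Polynomial.eq_of_infinite_eval_eq p q ?_
    refine (Set.infinite_range_of_injective (Nat.cast_injective (R := ℂ))).mono ?_
    rintro _ ⟨a, rfl⟩
    simp only [Set.mem_ofPred_eq, ← hp, ← hq, h]
  funext z
  rw [hp, hq, this]

theorem evalS_scalar_eq_sum (k : ℕ) (z β : ℂ) : evalS k z β =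
    (∏ i ∈ Finset.Icc 1 k, (β + (i : ℂ))) * ∑ j ∈ Finset.range (k / 2 + 1),
      (((k - 2 * j).factorial : ℂ) * ((2 * j).factorial : ℂ))⁻¹ *
        Polynomial.aeval β (T j) * z ^ (k - 2 * j) := by
  rw [evalS_scalar, SPoly_eq, Polynomial.eval_mul, Polynomial.eval_C, Polynomial.eval_finsetSum]
  simp only [Polynomial.eval_mul, Polynomial.eval_C, Polynomial.eval_pow, Polynomial.eval_X]

theorem isPolyFun_evalS (k : ℕ) {f g : ℂ → ℂ} (hf : IsPolyFun f) (hg : IsPolyFun g) :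
    IsPolyFun fun z => evalS k (f z) (g z) := by
  simp only [evalS_scalar_eq_sum]
  refine (isPolyFun_prod _ fun i _ => hg.add (isPolyFun_const _)).mul
    (isPolyFun_sum _ fun j _ => ((isPolyFun_const _).mul ?_).mul (hf.pow _))
  obtain ⟨p, hp⟩ := hg
  refine ⟨((T j).map (algebraMap ℚ ℂ)).comp p, fun z => ?_⟩
  simp only [Polynomial.eval_comp, Polynomial.eval_map_algebraMap, hp]

theorem isPolyFun_gaussInt_binomSer (μ : ℕ → ℂ) (w : ℂ[X]) (x : PowerSeries ℂ[X]) (m : ℕ) :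
    IsPolyFun fun β => gaussInt μ (binomSer w β * x) m := by
  simp only [gaussInt, PowerSeries.coeff_mul, Polynomial.finsetSum_coeff, binomSer,
    PowerSeries.coeff_mk, mul_assoc, Polynomial.algebraMap_apply, Polynomial.coeff_C_mul,
    Algebra.algebraMap_self, RingHom.id_apply]
  refine isPolyFun_sum _ fun r _ => (isPolyFun_const _).mul (isPolyFun_sum _ fun p _ => ?_)
  simp only [div_eq_mul_inv]
  exact ((isPolyFun_eval _).mul (isPolyFun_const _)).mul (isPolyFun_const _)

theorem evalS_zero (z β : ℂ) : evalS 0 z β = 1 := by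
  rw [evalS_scalar_eq_sum]
  simp [T]

theorem sum_evalS_mul_stepMoment {α : ℂ} {μ : ℕ → ℂ} (hα : α ≠ 0)
    (hμ : ∀ r, α ^ 2 * μ (r + 1) = (2 * r + 1) * μ r) (M : ℕ) :
    ∑ k ∈ Finset.range M, (-1) ^ (k + 1) *
      evalS (k + 1) ((M : ℂ) - 1 / 2 - ((k + 1 : ℕ) : ℂ) / 2) (α - ((k + 1 : ℕ) : ℂ)) *
        stepMoment μ α 0 (M - (k + 1)) = 0 := by
  have hpoly : (fun β => gaussInt μ (binomSer (stepPoly α) β * shiftExp α (0 : ℂ)) M) =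
      fun β => ∑ k ∈ Finset.range (M + 1),
      (-1) ^ k * evalS k ((M : ℂ) - 1 / 2 + (α - β) / 2 - k / 2) (β - k) *
        stepMoment μ α 0 (M - k) := by
    refine (isPolyFun_gaussInt_binomSer μ _ _ M).eq_of_natCast
      (isPolyFun_sum _ fun k _ => ((isPolyFun_const _).mul (isPolyFun_evalS k ?_ ?_)).mul
        (isPolyFun_const _)) fun a => ?_
    · exact ⟨Polynomial.C ((M : ℂ) - 1 / 2 + α / 2 - k / 2) - Polynomial.C (1 / 2) * Polynomial.X,
        fun z => by simp; ring⟩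
    · exact ⟨Polynomial.X - Polynomial.C (k : ℂ), fun z => by simp⟩
    · rw [binomSer_natCast]
      exact stepMoment_eq_sum hα hμ a M
  have h1 := congrFun hpoly α
  beta_reduce at h1
  -- At `β = α` the left side is the integral of a translate, equal to the term `k = 0` on the
  -- right.
  rw [stepPoly, binomSer_mul_shiftExp, gaussInt_shiftExp hμ, Finset.sum_range_succ', evalS_zero]
    at h1
  simp only [sub_self, zero_div, add_zero, pow_zero, one_mul, Nat.sub_zero] at h1
  have h2 : stepMoment μ α 0 M = gaussInt μ (shiftExp α (0 : ℂ)) M := by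
    rw [stepMoment, pow_zero, one_mul]
  rw [h2] at h1
  exact right_eq_add.mp h1

/-! ### The nir-transform of `f_α` -/

theorem taylorCoeff_fLog (α : ℂ) (k : ℕ) : taylorCoeff (fLog α) k = logCoeff α k := by
  have h1 : HasFPowerSeriesAt (fun x => Complex.log (1 + x))
      (FormalMultilinearSeries.ofScalars ℂ fun n : ℕ => -(-1 : ℂ) ^ n / n)
      ((α • ContinuousLinearMap.id ℂ ℂ) 0) := by
    rw [map_zero]
    exact hasFPowerSeriesAt_clog_one_add
  have h2 := (h1.compContinuousLinearMap).const_smul (c := α)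
  have h3 : (α • ((fun x => Complex.log (1 + x)) ∘ (α • ContinuousLinearMap.id ℂ ℂ))) =
      fLog α := by
    funext x
    simp [fLog]
  rw [h3] at h2
  have h4 := h2.analyticAt.hasFPowerSeriesAt.eq_formalMultilinearSeries h2
  have h5 := congrArg (fun p => FormalMultilinearSeries.coeff p k) h4
  simp only [FormalMultilinearSeries.coeff_ofScalars] at h5
  rw [taylorCoeff, h5, logCoeff, neg_pow α k]
  change α * (FormalMultilinearSeries.ofScalars ℂ (fun n : ℕ => -(-1 : ℂ) ^ n / n) k)
    (fun _ => α * 1) = _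
  rw [FormalMultilinearSeries.apply_eq_prod_smul_coeff, FormalMultilinearSeries.coeff_ofScalars]
  simp
  ring

theorem tangency_fLog {α : ℂ} (hα : α ≠ 0) : tangency (fLog α) = 1 := by
  have h1 : (1 : ℕ) ∈ {k : ℕ | taylorCoeff (fLog α) k ≠ 0} := by
    simp [taylorCoeff_fLog, logCoeff_one, hα]
  have h2 : tangency (fLog α) ≤ 1 := Nat.sInf_le h1
  have h3 : tangency (fLog α) ∈ {k : ℕ | taylorCoeff (fLog α) k ≠ 0} := Nat.sInf_mem ⟨1, h1⟩
  rcases Nat.le_one_iff_eq_zero_or_eq_one.mp h2 with h | h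
  · rw [h] at h3
    exact absurd (by rw [taylorCoeff_fLog, logCoeff_zero]) h3
  · exact h

theorem perturbation_fLog {α : ℂ} (hα : α ≠ 0) :
    -perturbation (fLog α) = quadSer ℂ α - upSer α (0 : ℂ) := by
  rw [← neg_sub, neg_inj]
  ext1 N
  rw [perturbation, PowerSeries.coeff_mk, map_sub, upSer, PowerSeries.coeff_mk, coeff_quadSer,
    tangency_fLog hα, taylorCoeff_fLog, Polynomial.C_0, add_zero, Polynomial.aeval_X_left_apply]
  congr 1
  split_ifs with h
  · subst h
    rw [logCoeff_one]
    norm_num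
  · rfl

theorem expNegCoeff_perturbation_fLog {α : ℂ} (hα : α ≠ 0) (N : ℕ) :
    expNegCoeff (perturbation (fLog α)) N = PowerSeries.coeff N (shiftExp α (0 : ℂ)) := by
  rw [expNegCoeff, perturbation_fLog hα, shiftExp, expS, PowerSeries.coeff_mk]
  rfl

/-- For `|arg α| < π/2` the principal square root of `α²` is `α`. -/
theorem hFull_eq_nirMain {α : ℂ} (hα : 0 < α.re) : hFull α = nirMain (fLog α) := by
  have h0 : α ≠ 0 := by
    rintro rfl
    simp at hα
  rw [nirMain, hFull, tangency_fLog h0, taylorCoeff_fLog, logCoeff_one]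
  congr 1
  have h1 : (1 : ℂ) / (((1 : ℕ) : ℂ) + 1) = ((2 : ℕ) : ℂ)⁻¹ := by norm_num
  have harg := Complex.abs_arg_lt_pi_div_two_iff.mpr (Or.inl hα)
  have harg' := abs_lt.mp harg
  rw [h1, Complex.pow_cpow_nat_inv]
  · norm_num
  · push_cast; linarith
  · push_cast; linarith

theorem logCoeff_neg (α : ℂ) (k : ℕ) : logCoeff (-α) k = (-1) ^ (k + 1) * logCoeff α k := by
  rw [logCoeff, logCoeff, neg_neg, pow_succ, neg_pow α k]
  have : ((-1 : ℂ) ^ k) * (-1) ^ k = 1 := by rw [← mul_pow]; simp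
  linear_combination (-(α * α ^ k / k)) * this

theorem betaStar_comp_neg_X (k : ℕ) :
    (betaStar k).comp (-Polynomial.X) = (-1) ^ (k + 1) * betaStar k := by
  have h1 := congrArg (fun p : ℚ[X] => (p.map (algebraMap ℚ ℂ)).comp
    (Polynomial.X + Polynomial.C (1 / 2))) (Polynomial.bernoulli_comp_one_sub_X (k + 1))
  simp only [Polynomial.map_comp, Polynomial.map_sub, Polynomial.map_one, Polynomial.map_X,
    Polynomial.comp_assoc, Polynomial.sub_comp, Polynomial.one_comp, Polynomial.X_comp,
    Polynomial.map_mul, Polynomial.map_pow, Polynomial.map_neg,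
    Polynomial.mul_comp, Polynomial.pow_comp, Polynomial.neg_comp] at h1
  rw [betaStar, Polynomial.mul_comp, Polynomial.C_comp, Polynomial.comp_assoc]
  have e1 : (Polynomial.X + Polynomial.C (1 / 2) : ℂ[X]).comp (-Polynomial.X) =
      1 - (Polynomial.X + Polynomial.C (1 / 2)) := by
    have : (Polynomial.C (1 / 2) + Polynomial.C (1 / 2) : ℂ[X]) = 1 := by
      rw [← Polynomial.C_add]; norm_num
    simp only [Polynomial.add_comp, Polynomial.X_comp, Polynomial.C_comp]
    linear_combination this
  rw [e1, h1]
  ring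

/-- Both the Taylor coefficients under `α ↦ -α` and `β*_k` under `τ ↦ -τ` change by `(-1)^(k+1)`. -/
theorem shiftExp_neg (α : ℂ) :
    shiftExp (-α) (0 : ℂ) =
      (shiftExp α (0 : ℂ)).map ((Polynomial.aeval (-Polynomial.X : ℂ[X]) :
        ℂ[X] →ₐ[ℂ] ℂ[X]) : ℂ[X] →+* ℂ[X]) := by
  rw [shiftExp, shiftExp, map_expS]
  congr 1
  ext1 N
  rw [PowerSeries.coeff_map, map_sub, map_sub, coeff_quadSer, coeff_quadSer, upSer, upSer,
    PowerSeries.coeff_mk, PowerSeries.coeff_mk, Polynomial.C_0, add_zero,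
    Polynomial.aeval_X_left_apply, logCoeff_neg]
  have e : Polynomial.aeval (-Polynomial.X) (betaStar N) = (-1) ^ (N + 1) * betaStar N :=
    betaStar_comp_neg_X N
  simp only [RingHom.coe_coe, map_sub, map_mul, e]
  congr 1
  · split_ifs <;> simp
  · simp
    ring

theorem coeff_shiftExp_neg (α : ℂ) (N p : ℕ) :
    (PowerSeries.coeff N (shiftExp (-α) (0 : ℂ))).coeff p =
      (-1) ^ p * (PowerSeries.coeff N (shiftExp α (0 : ℂ))).coeff p := by
  rw [shiftExp_neg, PowerSeries.coeff_map]
  change ((PowerSeries.coeff N (shiftExp α (0 : ℂ))).comp (-Polynomial.X)).coeff p = _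
  have : (-Polynomial.X : ℂ[X]) = Polynomial.C (-1) * Polynomial.X := by simp
  rw [this, Polynomial.comp_C_mul_X_coeff, mul_comm]

theorem laplaceFactor_neg (α : ℂ) (p : ℕ) :
    laplaceFactor 1 (-α) p = (-1) ^ (p + 1) * laplaceFactor 1 α p := by
  have h : ((-1 : ℂ) ^ (p + 1))⁻¹ = (-1) ^ (p + 1) := by
    rw [← inv_pow]; norm_num
  rw [laplaceFactor, laplaceFactor, neg_pow α, mul_inv, h]
  ring

theorem hFull_apply {α : ℂ} (hα : α ≠ 0) (q : ℚ) : hFull α q = ∑ᶠ x : ℕ × ℕ,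
    if (x.1 : ℚ) - ((x.2 : ℚ) + 1) / 2 = q then
      (PowerSeries.coeff x.1 (shiftExp α (0 : ℂ))).coeff x.2 * laplaceFactor 1 α x.2 /
        Complex.Gamma ((q : ℂ) + 1)
    else 0 := by
  rw [hFull, nir]
  refine finsum_congr fun x => ?_
  rw [tangency_fLog hα, expNegCoeff_perturbation_fLog hα]
  have : (x.1 : ℚ) - ((1 : ℕ) : ℚ) * ((x.2 : ℚ) + 1) / (((1 : ℕ) : ℚ) + 1) =
      (x.1 : ℚ) - ((x.2 : ℚ) + 1) / 2 := by norm_num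
  rw [this]

/-- The coefficient of `τ^p` changes by `(-1)^p` and the Laplace factor by `(-1)^(p+1)`. -/
theorem hFull_neg {α : ℂ} (hα : α ≠ 0) : hFull α = -hFull (-α) := by
  funext q
  rw [Pi.neg_apply, hFull_apply hα, hFull_apply (neg_ne_zero.mpr hα), ← finsum_neg_distrib]
  refine finsum_congr fun x => ?_
  split_ifs
  · rw [coeff_shiftExp_neg, laplaceFactor_neg]
    have : ((-1 : ℂ) ^ x.2) * (-1) ^ x.2 = 1 := by rw [← mul_pow]; simp
    rw [pow_succ]
    linear_combination (-((PowerSeries.coeff x.1 (shiftExp α (0 : ℂ))).coeff x.2 *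
      laplaceFactor 1 α x.2 / Complex.Gamma ((q : ℂ) + 1))) * this
  · simp

theorem h_neg {α : ℂ} (hα : α ≠ 0) : h α = -h (-α) := by
  funext q
  rw [Pi.neg_apply, h, h, singularPart, singularPart, hFull_neg hα]
  split_ifs <;> simp

/-! ### The coefficients of `h_α` as Gaussian integrals -/

/-- The Gaussian moments `∫ exp (-α² τ² / (2 n)) τ ^ (2 r) dτ`. -/
noncomputable def gaussMoment (α : ℂ) (r : ℕ) : ℂ := laplaceFactor 1 α (2 * r)

theorem gaussMoment_succ {α : ℂ} (hα : α ≠ 0) (r : ℕ) :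
    α ^ 2 * gaussMoment α (r + 1) = (2 * r + 1) * gaussMoment α r := by
  have h1 : (((2 * (r + 1) : ℕ) : ℂ) + 1) / (((1 : ℕ) : ℂ) + 1) = ((r : ℂ) + 1 / 2) + 1 := by
    push_cast; ring
  have h2 : (((2 * r : ℕ) : ℂ) + 1) / (((1 : ℕ) : ℂ) + 1) = (r : ℂ) + 1 / 2 := by
    push_cast; ring
  have h3 : ((r : ℂ) + 1 / 2) ≠ 0 := by
    intro h
    have := congrArg Complex.re h
    simp at this
    have h5 : (0 : ℝ) ≤ r := Nat.cast_nonneg r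
    linarith
  rw [gaussMoment, gaussMoment, laplaceFactor, laplaceFactor, h1, h2, Complex.Gamma_add_one _ h3,
    add_sub_right_comm _ (1 : ℂ) 1, Complex.cpow_add _ _ (by norm_num), Complex.cpow_one]
  rw [show 2 * (r + 1) + 1 = 2 + (2 * r + 1) by ring, pow_add α 2]
  push_cast
  field_simp
  ring

theorem gaussMoment_zero (α : ℂ) :
    gaussMoment α 0 = 1 / ((Real.sqrt 2 : ℂ) * α) * Complex.Gamma (1 / 2) := by
  have h1 : ((2 : ℂ)) ^ ((1 / 2 : ℂ) - 1) = (Real.sqrt 2 : ℂ)⁻¹ := by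
    rw [show (1 / 2 : ℂ) - 1 = -((1 / 2 : ℝ) : ℂ) by push_cast; ring, Complex.cpow_neg,
      show (2 : ℂ) = ((2 : ℝ) : ℂ) by simp, ← Complex.ofReal_cpow (by norm_num),
      ← Real.sqrt_eq_rpow]
  rw [gaussMoment, laplaceFactor]
  have h2 : (((2 * 0 : ℕ) : ℂ) + 1) / (((1 : ℕ) : ℂ) + 1) = 1 / 2 := by push_cast; ring
  have h3 : (((1 : ℕ) : ℂ) + 1) = 2 := by norm_num
  rw [h2, h3, h1, mul_zero, zero_add, pow_one, one_div (_ * _), mul_inv]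
  ring

/-- The series `∫ exp_# (-f_α^↑) dτ` over the real line. -/
noncomputable def moment (α : ℂ) (m : ℕ) : ℂ :=
  gaussInt (gaussMoment α) (shiftExp α (0 : ℂ)) m

theorem half_den_ne_one (m : ℤ) : ((m : ℚ) - 1 / 2).den ≠ 1 := by
  intro h
  have h1 := (Rat.den_eq_one_iff _).mp h
  have h2 : ((2 * ((m : ℚ) - 1 / 2).num : ℤ) : ℚ) = ((2 * m - 1 : ℤ) : ℚ) := by
    push_cast
    rw [h1]
    ring
  have h3 : 2 * ((m : ℚ) - 1 / 2).num = 2 * m - 1 := by exact_mod_cast h2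
  omega

theorem h_half {α : ℂ} (hα : α ≠ 0) (m : ℕ) :
    h α ((m : ℚ) - 1 / 2) = moment α m / Complex.Gamma (m + 1 / 2) := by
  have h0 := half_den_ne_one m
  rw [Int.cast_natCast] at h0
  rw [h, singularPart, if_neg h0, hFull_apply hα]
  have hinj : Set.InjOn (fun r : ℕ => (m + r, 2 * r)) (Finset.range (4 * m + 4)) := by
    intro a _ b _ hab
    have := congrArg Prod.snd hab
    change 2 * a = 2 * b at this
    omega
  -- The exponent condition reads `2N = p + 2m`, so `p = 2r` and `N = m + r`; the growth bound then
  -- gives `r ≤ 3m`.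
  rw [finsum_eq_sum_of_support_subset (s := (Finset.range (4 * m + 4)).image
    fun r : ℕ => (m + r, 2 * r)), Finset.sum_image hinj, moment, gaussInt, Finset.sum_div]
  · refine Finset.sum_congr rfl fun r _ => ?_
    rw [if_pos (by push_cast; ring), gaussMoment]
    have : (((m : ℚ) - 1 / 2 : ℚ) : ℂ) + 1 = m + 1 / 2 := by push_cast; ring
    rw [this, mul_comm]
    rfl
  · rintro ⟨N, p⟩ hx
    rw [Function.mem_support] at hx
    simp only [ne_eq, ite_eq_right_iff, not_forall] at hx
    obtain ⟨h1, h2⟩ := hx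
    have h3 : ((2 * N : ℕ) : ℚ) = ((p + 2 * m : ℕ) : ℚ) := by
      push_cast
      linarith
    have h4 : 2 * N = p + 2 * m := by exact_mod_cast h3
    have h5 : ¬ (3 * N + 0 < 2 * p) := fun h => h2 (by
      rw [(growth_shiftExp α (0 : ℂ)).coeff_eq_zero h]; simp)
    rw [Finset.mem_coe, Finset.mem_image]
    refine ⟨p / 2, Finset.mem_range.mpr (by omega), ?_⟩
    rw [Prod.mk.injEq]
    omega

/-- Odd powers of `τ` give integer exponents, removed by `singularPart`; half-integers below `-1/2`
are excluded by the growth bound. -/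
theorem h_eq_zero {α : ℂ} (hα : α ≠ 0) {q : ℚ} (hq : ∀ m : ℕ, q ≠ (m : ℚ) - 1 / 2) :
    h α q = 0 := by
  rw [h, singularPart]
  split_ifs with hden
  · rfl
  rw [hFull_apply hα]
  apply finsum_eq_zero_of_forall_eq_zero
  rintro ⟨N, p⟩
  split_ifs with h1
  · simp only [] at h1
    rcases Nat.even_or_odd' p with ⟨r, rfl | rfl⟩
    · have h2 : N < r := by
        by_contra hle
        apply hq (N - r)
        rw [← h1, Nat.cast_sub (not_lt.mp hle)]
        push_cast
        ring
      rw [(growth_shiftExp α (0 : ℂ)).coeff_eq_zero (by change 3 * N + 0 < _; omega)]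
      simp
    · exfalso
      apply hden
      have : q = ((N - (r + 1) : ℤ) : ℚ) := by
        rw [← h1]
        push_cast
        ring
      rw [this]
      exact Rat.den_intCast _
  · rfl

theorem moment_zero (α : ℂ) : moment α 0 = gaussMoment α 0 := by
  rw [moment, gaussInt, Finset.sum_eq_single 0]
  · have h1 : PowerSeries.coeff 0 (shiftExp α (0 : ℂ)) = 1 := coeff_zero_expS _
    rw [add_zero, h1]
    simp
  · intro r _ hr
    rw [(growth_shiftExp α (0 : ℂ)).coeff_eq_zero (by omega), mul_zero]
  · simp

theorem sum_evalS_mul_moment {α : ℂ} (hα : α ≠ 0) (M : ℕ) :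
    ∑ k ∈ Finset.range M, (-1) ^ (k + 1) *
      evalS (k + 1) ((M : ℂ) - 1 / 2 - ((k + 1 : ℕ) : ℂ) / 2) (α - ((k + 1 : ℕ) : ℂ)) *
        moment α (M - (k + 1)) = 0 := by
  have h1 := sum_evalS_mul_stepMoment hα (gaussMoment_succ hα) M
  simpa [stepMoment, moment] using h1

theorem Gamma_half_eq_prod_mul {k M : ℕ} (hk : k ≤ M) : Complex.Gamma ((M : ℂ) + 1 / 2) =
    (∏ i ∈ Finset.range k, ((M : ℂ) - 1 / 2 - i)) *
      Complex.Gamma (((M - k : ℕ) : ℂ) + 1 / 2) := by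
  induction k with
  | zero => simp
  | succ k ih =>
    have h1 : ((M - k : ℕ) : ℂ) + 1 / 2 = (((M - (k + 1) : ℕ) : ℂ) + 1 / 2) + 1 := by
      rw [Nat.cast_sub hk, Nat.cast_sub (by omega)]
      push_cast
      ring
    have h2 : ((M - (k + 1) : ℕ) : ℂ) + 1 / 2 ≠ 0 := by
      intro h
      have := congrArg Complex.re h
      simp only [Complex.add_re, Complex.natCast_re, Complex.zero_re] at this
      have h5 : (0 : ℝ) ≤ ((M - (k + 1) : ℕ) : ℝ) := Nat.cast_nonneg _
      norm_num at this
      linarith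
    rw [ih (by omega), h1, Complex.Gamma_add_one _ h2, Finset.prod_range_succ, ← mul_assoc]
    congr 2
    rw [Nat.cast_sub hk]
    push_cast
    ring

theorem Gamma_half_ne_zero (M : ℕ) : Complex.Gamma ((M : ℂ) + 1 / 2) ≠ 0 := by
  apply Complex.Gamma_ne_zero_of_re_pos
  simp only [Complex.add_re, Complex.natCast_re]
  have h5 : (0 : ℝ) ≤ (M : ℝ) := Nat.cast_nonneg _
  norm_num
  linarith

theorem prod_half_ne_zero {k M : ℕ} (hk : k ≤ M) :
    ∏ i ∈ Finset.range k, ((M : ℂ) - 1 / 2 - i) ≠ 0 := fun h0 =>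
  Gamma_half_ne_zero M (by rw [Gamma_half_eq_prod_mul hk, h0, zero_mul])

/-- At the exponent `M - 1/2` only `j < M` contributes. The denominators from `integ` and from the
Borel transform combine to the common `Γ(M + 1/2)`, and the reflection supplies the signs, so the
sum is a multiple of `sum_evalS_mul_moment`. -/
theorem hasSum_integ_evalS_reflect_h {α : ℂ} (hα : α ≠ 0) :
    HasSum (fun j : ℕ => (integ ^ (j + 1)) (evalS (j + 1)
      (euler + algebraMap ℂ (Module.End ℂ Ser) (((j + 1 : ℕ) : ℂ) / 2))
      (α - ((j + 1 : ℕ) : ℂ)) (reflect (h α)))) 0 := by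
  rw [Pi.hasSum]
  intro q
  have hval : ∀ j : ℕ, (integ ^ (j + 1)) (evalS (j + 1)
      (euler + algebraMap ℂ (Module.End ℂ Ser) (((j + 1 : ℕ) : ℂ) / 2))
      (α - ((j + 1 : ℕ) : ℂ)) (reflect (h α))) q =
      evalS (j + 1) (((q - ((j + 1 : ℕ) : ℚ) : ℚ) : ℂ) + ((j + 1 : ℕ) : ℂ) / 2)
        (α - ((j + 1 : ℕ) : ℂ)) * ((-1) ^ ((q - ((j + 1 : ℕ) : ℚ) : ℚ) : ℂ) *
        h α (q - ((j + 1 : ℕ) : ℚ))) / ∏ i ∈ Finset.range (j + 1), ((q : ℂ) - i) := by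
    intro j
    rw [integ_pow_apply, evalS_euler_apply]
    rfl
  by_cases hq : ∃ M : ℕ, q = (M : ℚ) - 1 / 2
  · obtain ⟨M, rfl⟩ := hq
    have hzero : ∀ j ∉ Finset.range M, (integ ^ (j + 1)) (evalS (j + 1)
        (euler + algebraMap ℂ (Module.End ℂ Ser) (((j + 1 : ℕ) : ℂ) / 2))
        (α - ((j + 1 : ℕ) : ℂ)) (reflect (h α))) ((M : ℚ) - 1 / 2) = 0 := by
      intro j hj
      rw [hval, h_eq_zero hα]
      · simp
      · intro m hm
        have h1 : ((M : ℕ) : ℚ) = ((m + (j + 1) : ℕ) : ℚ) := by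
          push_cast at hm ⊢
          linarith
        have h2 : M = m + (j + 1) := by exact_mod_cast h1
        exact hj (Finset.mem_range.mpr (by omega))
    have hs := hasSum_sum_of_ne_finset_zero hzero (L := SummationFilter.unconditional ℕ)
    convert hs using 1
    rw [Pi.zero_apply]
    have hterm : ∀ j ∈ Finset.range M, (integ ^ (j + 1)) (evalS (j + 1)
        (euler + algebraMap ℂ (Module.End ℂ Ser) (((j + 1 : ℕ) : ℂ) / 2))
        (α - ((j + 1 : ℕ) : ℂ)) (reflect (h α))) ((M : ℚ) - 1 / 2) =
        ((-1) ^ ((M : ℂ) - 1 / 2) / Complex.Gamma ((M : ℂ) + 1 / 2)) * ((-1) ^ (j + 1) *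
        evalS (j + 1) ((M : ℂ) - 1 / 2 - ((j + 1 : ℕ) : ℂ) / 2) (α - ((j + 1 : ℕ) : ℂ)) *
          moment α (M - (j + 1))) := by
      intro j hj
      have hj' : j + 1 ≤ M := Finset.mem_range.mp hj
      rw [hval]
      have e1 : (M : ℚ) - 1 / 2 - ((j + 1 : ℕ) : ℚ) = ((M - (j + 1) : ℕ) : ℚ) - 1 / 2 := by
        rw [Nat.cast_sub hj']
        ring
      have e2 : ((((M : ℚ) - 1 / 2 - ((j + 1 : ℕ) : ℚ) : ℚ)) : ℂ) + ((j + 1 : ℕ) : ℂ) / 2 =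
          (M : ℂ) - 1 / 2 - ((j + 1 : ℕ) : ℂ) / 2 := by
        push_cast
        ring
      have e3 : ((-1 : ℂ)) ^ ((((M : ℚ) - 1 / 2 - ((j + 1 : ℕ) : ℚ) : ℚ)) : ℂ) =
          (-1) ^ ((M : ℂ) - 1 / 2) * (-1) ^ (j + 1) := by
        have : ((((M : ℚ) - 1 / 2 - ((j + 1 : ℕ) : ℚ) : ℚ)) : ℂ) =
          ((M : ℂ) - 1 / 2) - ((j + 1 : ℕ) : ℂ) := by push_cast; ring
        rw [this, Complex.cpow_sub _ _ (by norm_num), Complex.cpow_natCast, div_eq_mul_inv,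
          ← inv_pow]
        norm_num
      have e4 : (((M : ℚ) - 1 / 2 : ℚ) : ℂ) = (M : ℂ) - 1 / 2 := by push_cast; ring
      rw [e2, e3, e1, h_half hα, e4, Gamma_half_eq_prod_mul hj']
      have n1 := prod_half_ne_zero hj'
      have n2 := Gamma_half_ne_zero (M - (j + 1))
      field_simp
    rw [Finset.sum_congr rfl hterm, ← Finset.mul_sum, sum_evalS_mul_moment hα, mul_zero]
  · have hzero : ∀ j : ℕ, (integ ^ (j + 1)) (evalS (j + 1)
        (euler + algebraMap ℂ (Module.End ℂ Ser) (((j + 1 : ℕ) : ℂ) / 2))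
        (α - ((j + 1 : ℕ) : ℂ)) (reflect (h α))) q = 0 := by
      intro j
      rw [hval, h_eq_zero hα]
      · simp
      · intro m hm
        apply hq
        refine ⟨m + (j + 1), ?_⟩
        push_cast at hm ⊢
        linarith
    simp only [hzero]
    exact hasSum_zero

/-! ### The polynomials `γ_{-1/2+n}` -/

/-- The value of `γ_{-1/2+n}` at `α ^ 2`. -/
noncomputable def gammaVal (α : ℂ) (n : ℕ) : ℂ :=
  (Real.sqrt 2 : ℂ) * α * h α ((n : ℚ) - 1 / 2)

theorem sqrt_two_ne_zero : (Real.sqrt 2 : ℂ) ≠ 0 := by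
  rw [Complex.ofReal_ne_zero]
  positivity

theorem moment_eq {α : ℂ} (hα : α ≠ 0) (n : ℕ) : moment α n =
    1 / ((Real.sqrt 2 : ℂ) * α) * Complex.Gamma (n + 1 / 2) * gammaVal α n := by
  have h1 := Gamma_half_ne_zero n
  have h2 := sqrt_two_ne_zero
  rw [gammaVal, h_half hα]
  generalize Complex.Gamma ((n : ℂ) + 1 / 2) = G at *
  field_simp

theorem gammaVal_zero {α : ℂ} (hα : α ≠ 0) : gammaVal α 0 = 1 := by
  have h1 := moment_eq hα 0
  have h2 := sqrt_two_ne_zero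
  have h3 := Gamma_half_ne_zero 0
  rw [moment_zero, gaussMoment_zero] at h1
  simp only [Nat.cast_zero, zero_add] at h1 h3
  have h4 : 1 / ((Real.sqrt 2 : ℂ) * α) * Complex.Gamma (1 / 2) ≠ 0 :=
    mul_ne_zero (one_div_ne_zero (mul_ne_zero h2 hα)) h3
  exact (mul_eq_left₀ h4).mp h1.symm

theorem gammaVal_neg {α : ℂ} (hα : α ≠ 0) (n : ℕ) : gammaVal (-α) n = gammaVal α n := by
  rw [gammaVal, gammaVal, h_neg hα, Pi.neg_apply]
  ring

theorem evalS_one (z β : ℂ) : evalS 1 z β = (β + 1) * z := by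
  rw [evalS_scalar_eq_sum]
  simp [T]

/-- This is `sum_evalS_mul_moment` at `M = n + 1`, solved for its first term, where `S_1(n, α - 1) =
nα`. -/
theorem moment_recursion {α : ℂ} (hα : α ≠ 0) (n : ℕ) :
    (n : ℂ) * α * moment α n = ∑ k ∈ Finset.Icc 1 n, (-1) ^ (k + 1) *
      evalS (k + 1) ((n : ℂ) - (k : ℂ) / 2) (α - k - 1) * moment α (n - k) := by
  have h1 := sum_evalS_mul_moment hα (n + 1)
  rw [Finset.sum_range_succ', zero_add, evalS_one] at h1
  have h2 : ∑ k ∈ Finset.Icc 1 n, (-1) ^ (k + 1) *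
      evalS (k + 1) ((n : ℂ) - (k : ℂ) / 2) (α - k - 1) * moment α (n - k) =
      ∑ k ∈ Finset.range n, (-1) ^ (k + 1 + 1) *
      evalS (k + 1 + 1) (((n + 1 : ℕ) : ℂ) - 1 / 2 - ((k + 1 + 1 : ℕ) : ℂ) / 2)
        (α - ((k + 1 + 1 : ℕ) : ℂ)) * moment α (n + 1 - (k + 1 + 1)) := by
    rw [Finset.range_eq_Ico, Finset.sum_Ico_add' (fun k => (-1) ^ (k + 1) *
      evalS (k + 1) (((n + 1 : ℕ) : ℂ) - 1 / 2 - ((k + 1 : ℕ) : ℂ) / 2)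
        (α - ((k + 1 : ℕ) : ℂ)) * moment α (n + 1 - (k + 1))) 0 n 1]
    refine Finset.sum_congr (by ext; simp [Finset.mem_Icc, Finset.mem_Ico])
      fun k _ => ?_
    have e1 : ((n + 1 : ℕ) : ℂ) - 1 / 2 - ((k + 1 : ℕ) : ℂ) / 2 = (n : ℂ) - (k : ℂ) / 2 := by
      push_cast; ring
    have e2 : α - ((k + 1 : ℕ) : ℂ) = α - k - 1 := by push_cast; ring
    rw [e1, e2, Nat.add_sub_add_right]
  rw [h2]
  have e3 : n + 1 - 1 = n := by omega
  rw [e3] at h1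
  push_cast at h1 ⊢
  linear_combination -h1

theorem gammaVal_recursion {α : ℂ} (hα : α ≠ 0) {n : ℕ} (hn : 1 ≤ n) :
    gammaVal α n = ∑ k ∈ Finset.Icc 1 n, (-1 : ℂ) ^ (k + 1) *
      (Complex.Gamma (1 / 2 + (n : ℂ) - k) / Complex.Gamma (1 / 2 + (n : ℂ))) *
      (evalS (k + 1) ((n : ℂ) - (k : ℂ) / 2) (α - k - 1) / ((n : ℂ) * α)) *
      gammaVal α (n - k) := by
  have h1 := moment_recursion hα n
  have h2 : ∀ k ∈ Finset.Icc 1 n, (-1) ^ (k + 1) *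
      evalS (k + 1) ((n : ℂ) - (k : ℂ) / 2) (α - k - 1) * moment α (n - k) =
      (1 / ((Real.sqrt 2 : ℂ) * α) * Complex.Gamma (n + 1 / 2)) * (n * α) * ((-1 : ℂ) ^ (k + 1) *
      (Complex.Gamma (1 / 2 + (n : ℂ) - k) / Complex.Gamma (1 / 2 + (n : ℂ))) *
      (evalS (k + 1) ((n : ℂ) - (k : ℂ) / 2) (α - k - 1) / ((n : ℂ) * α)) *
      gammaVal α (n - k)) := by
    intro k hk
    have hkn := (Finset.mem_Icc.mp hk).2
    have e1 : (1 / 2 : ℂ) + n - k = ((n - k : ℕ) : ℂ) + 1 / 2 := by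
      rw [Nat.cast_sub hkn]; ring
    have e2 : (1 / 2 : ℂ) + n = (n : ℂ) + 1 / 2 := by ring
    have n1 := Gamma_half_ne_zero n
    have n2 : (n : ℂ) ≠ 0 := Nat.cast_ne_zero.mpr (by omega)
    have n3 := sqrt_two_ne_zero
    rw [moment_eq hα, e1, e2]
    generalize Complex.Gamma ((n : ℂ) + 1 / 2) = G at *
    generalize Complex.Gamma (((n - k : ℕ) : ℂ) + 1 / 2) = G' at *
    field_simp
  rw [Finset.sum_congr rfl h2, ← Finset.mul_sum, moment_eq hα] at h1
  have n1 := Gamma_half_ne_zero n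
  have n2 : (n : ℂ) ≠ 0 := Nat.cast_ne_zero.mpr (by omega)
  have n3 := sqrt_two_ne_zero
  refine mul_left_cancel₀ (mul_ne_zero (mul_ne_zero (one_div_ne_zero (mul_ne_zero n3 hα)) n1)
    (mul_ne_zero n2 hα)) ?_
  rw [← h1]
  ring

/-! ### Polynomiality, degree and parity -/

/-- `S_{k+1} (n - k/2, X - k - 1) / X` as a polynomial in `X`. -/
noncomputable def SQuot (n k : ℕ) : ℚ[X] :=
  (∏ i ∈ Finset.Icc 1 k, (Polynomial.X + Polynomial.C ((i : ℚ) - k - 1))) *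
    ∑ j ∈ Finset.range ((k + 1) / 2 + 1),
      Polynomial.C ((((k + 1 - 2 * j).factorial : ℚ) * ((2 * j).factorial : ℚ))⁻¹ *
        ((n : ℚ) - k / 2) ^ (k + 1 - 2 * j)) *
        (T j).comp (Polynomial.X + Polynomial.C (-(k : ℚ) - 1))

/-- The factor `i = k + 1` of the product in `S_{k+1}` equals `α` at `β = α - k - 1`. -/
theorem aeval_SQuot (α : ℂ) (n k : ℕ) :
    α * Polynomial.aeval α (SQuot n k) =
      evalS (k + 1) ((n : ℂ) - (k : ℂ) / 2) (α - k - 1) := by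
  rw [evalS_scalar_eq_sum, Finset.prod_Icc_succ_top (Nat.le_add_left 1 k), SQuot, map_mul,
    map_prod, map_sum, ← mul_assoc]
  congr 1
  · have e1 : α - k - 1 + ((k + 1 : ℕ) : ℂ) = α := by push_cast; ring
    rw [e1, mul_comm]
    congr 1
    refine Finset.prod_congr rfl fun i _ => ?_
    simp
    ring
  · refine Finset.sum_congr rfl fun j _ => ?_
    have e2 : Polynomial.aeval α ((T j).comp (Polynomial.X + Polynomial.C (-(k : ℚ) - 1))) =
        Polynomial.aeval (α - k - 1) (T j) := by
      rw [Polynomial.aeval_comp]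
      congr 2
      simp
      ring
    rw [map_mul, e2, Polynomial.aeval_C]
    simp
    ring

theorem natDegree_T_le (j : ℕ) : (T j).natDegree ≤ j := by
  rw [T]
  refine (Polynomial.natDegree_C_mul_le _ _).trans ?_
  refine Polynomial.natDegree_sum_le_of_forall_le _ _ fun i hi => ?_
  refine (Polynomial.natDegree_C_mul_le _ _).trans ?_
  rw [descPochhammer_natDegree]
  exact Finset.mem_range_succ_iff.mp hi

theorem natDegree_SQuot_le (n k : ℕ) : (SQuot n k).natDegree ≤ k + (k + 1) / 2 := by
  refine Polynomial.natDegree_mul_le.trans (add_le_add ?_ ?_)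
  · refine (Polynomial.natDegree_prod_le _ _).trans ?_
    simp only [Polynomial.natDegree_X_add_C]
    simp
  · refine Polynomial.natDegree_sum_le_of_forall_le _ _ fun j hj => ?_
    refine (Polynomial.natDegree_C_mul_le _ _).trans (Polynomial.natDegree_comp_le.trans ?_)
    rw [Polynomial.natDegree_X_add_C, mul_one]
    exact (natDegree_T_le j).trans (Finset.mem_range_succ_iff.mp hj)

theorem T_zero : T 0 = 1 := by simp [T]

theorem T_one : T 1 = Polynomial.C (1 / 12) * Polynomial.X := by
  have h1 : PowerSeries.coeff 2 sinhc = 1 / 24 := by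
    rw [sinhc, PowerSeries.coeff_mk, if_pos (by decide)]
    norm_num [Nat.factorial]
  have h2 : PowerSeries.coeff 2 (1 : PowerSeries ℚ) = 0 := by
    rw [PowerSeries.coeff_one]; simp
  simp only [T, Finset.sum_range_succ, Finset.sum_range_zero, pow_zero, pow_one, mul_one, map_sub,
    h1, h2, descPochhammer_one, Nat.factorial_one, zero_add]
  rw [zero_div, Polynomial.C_0, zero_mul, zero_add, ← mul_assoc, ← Polynomial.C_mul]
  norm_num [Nat.factorial]

theorem coeff_two_SQuot_one (n : ℕ) : (SQuot n 1).coeff 2 = 1 / 24 := by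
  simp only [SQuot, Finset.Icc_self, Finset.prod_singleton, Finset.sum_range_succ,
    Finset.sum_range_zero, T_zero, T_one, Nat.reduceAdd, Nat.reduceDiv, zero_add,
    Polynomial.one_comp, Polynomial.mul_comp, Polynomial.C_comp, Polynomial.X_comp, mul_one]
  have : ∀ a b c d e : ℚ, ((Polynomial.X + Polynomial.C a) * (Polynomial.C b + Polynomial.C c *
      (Polynomial.C d * (Polynomial.X + Polynomial.C e))) : ℚ[X]) =
      Polynomial.C (c * d) * Polynomial.X ^ 2 + Polynomial.C (b + c * d * e + a * c * d) *
        Polynomial.X + Polynomial.C (a * (b + c * d * e)) := by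
    intro a b c d e
    simp only [Polynomial.C_add, Polynomial.C_mul]
    ring
  rw [this, Polynomial.coeff_add, Polynomial.coeff_add, Polynomial.coeff_C_mul,
    Polynomial.coeff_C_mul, Polynomial.coeff_X_pow, Polynomial.coeff_X, Polynomial.coeff_C]
  norm_num [Nat.factorial]

theorem exists_polynomial_gammaVal (n : ℕ) : ∃ p : ℚ[X], p.natDegree ≤ 2 * n ∧
    p.coeff (2 * n) ≠ 0 ∧ ∀ α : ℂ, α ≠ 0 → Polynomial.aeval α p = gammaVal α n := by
  induction n using Nat.strong_induction_on with
  | _ n ih =>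
    rcases Nat.eq_zero_or_pos n with rfl | hn
    · exact ⟨1, by simp, by simp, fun α hα => by simp [gammaVal_zero hα]⟩
    · choose! p hdeg hlead hval using ih
      set c : ℕ → ℚ := fun k => (-1) ^ (k + 1) *
        ((∏ i ∈ Finset.range k, ((n : ℚ) - 1 / 2 - i))⁻¹ * (n : ℚ)⁻¹) with hc
      have hdegterm : ∀ k ∈ Finset.Icc 1 n,
          (Polynomial.C (c k) * (SQuot n k * p (n - k))).natDegree ≤
            k + (k + 1) / 2 + 2 * (n - k) := by
        intro k hk
        have hk' := Finset.mem_Icc.mp hk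
        exact (Polynomial.natDegree_C_mul_le _ _).trans (Polynomial.natDegree_mul_le.trans
          (add_le_add (natDegree_SQuot_le n k) (hdeg (n - k) (by omega))))
      refine ⟨∑ k ∈ Finset.Icc 1 n, Polynomial.C (c k) * (SQuot n k * p (n - k)), ?_, ?_, ?_⟩
      · refine Polynomial.natDegree_sum_le_of_forall_le _ _ fun k hk => ?_
        have hk' := Finset.mem_Icc.mp hk
        have := hdegterm k hk
        omega
      -- The degree bound `k + ⌊(k+1)/2⌋ + 2(n-k)` reaches `2n` only for `k = 1`, where the
      -- coefficient `1/24` comes from `T_2(β) = β/12`.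
      · rw [Polynomial.finsetSum_coeff, Finset.sum_eq_single 1]
        · rw [Polynomial.coeff_C_mul, show 2 * n = 2 + 2 * (n - 1) by omega,
            Polynomial.coeff_mul_add_eq_of_natDegree_le (natDegree_SQuot_le n 1)
              (hdeg (n - 1) (by omega)), coeff_two_SQuot_one]
          refine mul_ne_zero ?_ (mul_ne_zero (by norm_num) (hlead (n - 1) (by omega)))
          have h1 : (1 : ℚ) ≤ n := by exact_mod_cast hn
          have h2 : ((n : ℚ) - 1 / 2) ≠ 0 := by linarith
          simp only [hc, Finset.prod_range_one, Nat.cast_zero, sub_zero]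
          refine mul_ne_zero (pow_ne_zero _ (by norm_num)) (mul_ne_zero (inv_ne_zero h2)
            (inv_ne_zero (by linarith)))
        · intro k hk hk1
          have hk' := Finset.mem_Icc.mp hk
          refine Polynomial.coeff_eq_zero_of_natDegree_lt ((hdegterm k hk).trans_lt ?_)
          omega
        · intro h1
          exact absurd (Finset.mem_Icc.mpr ⟨le_refl 1, hn⟩) h1
      · intro α hα
        rw [gammaVal_recursion hα hn, map_sum]
        refine Finset.sum_congr rfl fun k hk => ?_
        have hk' := Finset.mem_Icc.mp hk
        rw [map_mul, map_mul _ (SQuot n k), hval (n - k) (by omega) α hα, ← aeval_SQuot, Polynomial.aeval_C]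
        have e1 : (1 / 2 : ℂ) + n - k = ((n - k : ℕ) : ℂ) + 1 / 2 := by
          rw [Nat.cast_sub hk'.2]; ring
        have e2 : (1 / 2 : ℂ) + n = (n : ℂ) + 1 / 2 := by ring
        rw [e1, e2, Gamma_half_eq_prod_mul hk'.2]
        have n1 := prod_half_ne_zero hk'.2
        have n2 := Gamma_half_ne_zero (n - k)
        have n3 : (n : ℂ) ≠ 0 := Nat.cast_ne_zero.mpr (by omega)
        have e3 : algebraMap ℚ ℂ (c k) = (-1) ^ (k + 1) *
            ((∏ i ∈ Finset.range k, ((n : ℂ) - 1 / 2 - i))⁻¹ * (n : ℂ)⁻¹) := by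
          simp [hc]
        rw [e3]
        generalize ∏ i ∈ Finset.range k, ((n : ℂ) - 1 / 2 - i) = G at *
        generalize Complex.Gamma (((n - k : ℕ) : ℂ) + 1 / 2) = G' at *
        field_simp

/-- The polynomial in `α` of degree `2n` is even because `gammaVal` is, hence a polynomial of degree
`n` in `α²`. -/
theorem exists_polynomial_sq_gammaVal (n : ℕ) : ∃ γ : ℚ[X], γ.degree = n ∧
    ∀ α : ℂ, α ≠ 0 → Polynomial.aeval (α ^ 2) γ = gammaVal α n := by
  obtain ⟨p, hdeg, hlead, hval⟩ := exists_polynomial_gammaVal n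
  have heven : p.comp (Polynomial.C (-1) * Polynomial.X) = p := by
    refine Polynomial.eq_of_infinite_eval_eq _ _ ?_
    -- Positive integers avoid `α = 0`, where the values of `p` are not known to be those of
    -- `gammaVal`.
    refine (Set.infinite_range_of_injective (f := fun a : ℕ => (a : ℚ) + 1) ?_).mono ?_
    · intro a b hab
      simpa using hab
    · rintro _ ⟨a, rfl⟩
      have h0 : (((a : ℚ) + 1 : ℚ) : ℂ) ≠ 0 := by
        push_cast
        exact Nat.cast_add_one_ne_zero a
      have h1 := hval _ h0
      have h2 := hval _ (neg_ne_zero.mpr h0)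
      rw [gammaVal_neg h0, ← h1, ← Rat.cast_neg] at h2
      have h3 : ∀ r : ℚ, Polynomial.aeval ((r : ℚ) : ℂ) p = ((p.eval r : ℚ) : ℂ) := by
        intro r
        have := Polynomial.aeval_algebraMap_apply_eq_algebraMap_eval (A := ℂ) r p
        simpa using this
      rw [h3, h3] at h2
      have h4 := Rat.cast_injective h2
      simp only [Set.mem_ofPred_eq, Polynomial.eval_comp, Polynomial.eval_mul, Polynomial.eval_C,
        Polynomial.eval_X, neg_one_mul]
      exact h4
  have hodd : ∀ i, ¬ 2 ∣ i → p.coeff i = 0 := by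
    intro i hi
    have h1 := congrArg (fun q => q.coeff i) heven
    simp only [Polynomial.comp_C_mul_X_coeff] at h1
    have h2 : Odd i := Nat.not_even_iff_odd.mp (fun h => hi h.two_dvd)
    rw [h2.neg_one_pow] at h1
    linarith
  have hexp : Polynomial.expand ℚ 2 (Polynomial.contract 2 p) = p := by
    ext1 i
    rw [Polynomial.coeff_expand two_pos]
    split_ifs with h
    · rw [Polynomial.coeff_contract two_ne_zero, Nat.div_mul_cancel h]
    · exact (hodd i h).symm
  refine ⟨Polynomial.contract 2 p, ?_, fun α hα => ?_⟩
  · refine le_antisymm ?_ ?_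
    · rw [Polynomial.degree_le_iff_coeff_zero]
      intro m hm
      rw [Polynomial.coeff_contract two_ne_zero]
      have : n < m := by exact_mod_cast hm
      exact Polynomial.coeff_eq_zero_of_natDegree_lt (by omega)
    · refine Polynomial.le_degree_of_ne_zero ?_
      rwa [Polynomial.coeff_contract two_ne_zero, mul_comm]
  · rw [← hval α hα, ← Polynomial.expand_aeval, hexp]

theorem hasSum_gammaVal_mono {α : ℂ} (hα : α ≠ 0) :
    HasSum (fun n : ℕ => (1 / ((Real.sqrt 2 : ℂ) * α) * gammaVal α n) •
      mono ((n : ℚ) - 1 / 2)) (h α) := by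
  have hcoef : ∀ n : ℕ, 1 / ((Real.sqrt 2 : ℂ) * α) * gammaVal α n = h α ((n : ℚ) - 1 / 2) := by
    intro n
    have := sqrt_two_ne_zero
    rw [gammaVal]
    field_simp
  simp only [hcoef]
  rw [Pi.hasSum]
  intro q
  have hne : ∀ n : ℕ, q ≠ (n : ℚ) - 1 / 2 →
      (h α ((n : ℚ) - 1 / 2) • mono ((n : ℚ) - 1 / 2)) q = 0 := by
    intro n hn
    rw [Pi.smul_apply, mono, Pi.single_eq_of_ne hn, smul_zero]
  by_cases hq : ∃ m : ℕ, q = (m : ℚ) - 1 / 2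
  · obtain ⟨m, rfl⟩ := hq
    have hs := hasSum_single (f := fun n : ℕ =>
      (h α ((n : ℚ) - 1 / 2) • mono ((n : ℚ) - 1 / 2)) ((m : ℚ) - 1 / 2)) m (fun n hn => by
        apply hne
        intro heq
        apply hn
        have : (m : ℚ) = n := by linarith
        exact_mod_cast this.symm)
    convert hs using 1
    simp [mono]
  · push Not at hq
    rw [h_eq_zero hα hq]
    simp only [hne _ (hq _)]
    exact hasSum_zero

end Nir

theorem mainTheorem10 :
    -- the determination used for `h_α` is the main one when `Re α > 0`
    (∀ α : ℂ, 0 < α.re → Nir.hFull α = Nir.nirMain (Nir.fLog α)) ∧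
    -- `h_α = - h_{-α}`, for the whole nir-transform and for its singular part
    (∀ α : ℂ, α ≠ 0 → Nir.hFull α = - Nir.hFull (-α) ∧ Nir.h α = - Nir.h (-α)) ∧
    -- `(d + D)^a = ∑_k S_k(D + (a - k)/2, a - k) d^(a - k)` whenever `[d, D] = d`
    (∀ (A : Type) [Ring A] [Algebra ℂ A] (d D : A), d * D - D * d = d → ∀ a : ℕ,
      (d + D) ^ a = ∑ k ∈ Finset.range (a + 1),
        Nir.evalS k (D + algebraMap ℂ A (((a : ℂ) - k) / 2)) ((a : ℂ) - k) * d ^ (a - k)) ∧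
    -- `S_k(ν∂_ν + k/2, α - k)` multiplies each monomial by a scalar
    (∀ (k : ℕ) (α : ℂ) (q : ℚ),
      Nir.evalS k (Nir.euler + algebraMap ℂ (Module.End ℂ Nir.Ser) ((k : ℂ) / 2)) (α - k)
          (Nir.mono q) =
        Nir.evalS k ((q : ℂ) + (k : ℂ) / 2) (α - k) • Nir.mono q) ∧
    -- `∑_{k ≥ 1} ∂_ν^{-k} S_k(ν∂_ν + k/2, α - k) h_α(-ν) = 0`
    (∀ α : ℂ, α ≠ 0 →
      HasSum (fun j : ℕ =>
        (Nir.integ ^ (j + 1))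
          (Nir.evalS (j + 1)
            (Nir.euler + algebraMap ℂ (Module.End ℂ Nir.Ser) (((j + 1 : ℕ) : ℂ) / 2))
            (α - ((j + 1 : ℕ) : ℂ)) (Nir.reflect (Nir.h α)))) 0) ∧
    -- the expansion of `h_α`, and the induction for the coefficients `γ n = γ_{-1/2+n}`
    ∃ γ : ℕ → ℚ[X],
      (∀ n : ℕ, (γ n).degree = n) ∧
      γ 0 = 1 ∧
      (∀ α : ℂ, α ≠ 0 →
        HasSum (fun n : ℕ =>
          (1 / ((Real.sqrt 2 : ℂ) * α) * Polynomial.aeval (α ^ 2) (γ n)) •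
            Nir.mono ((n : ℚ) - 1 / 2)) (Nir.h α)) ∧
      (∀ α : ℂ, α ≠ 0 → ∀ n : ℕ, 1 ≤ n →
        Polynomial.aeval (α ^ 2) (γ n) =
          ∑ k ∈ Finset.Icc 1 n,
            (-1 : ℂ) ^ (k + 1) *
              (Complex.Gamma (1 / 2 + (n : ℂ) - k) / Complex.Gamma (1 / 2 + (n : ℂ))) *
              (Nir.evalS (k + 1) ((n : ℂ) - (k : ℂ) / 2) (α - k - 1) / ((n : ℂ) * α)) *
              Polynomial.aeval (α ^ 2) (γ (n - k))) := by
  choose γ hdeg hval using Nir.exists_polynomial_sq_gammaVal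
  refine ⟨fun α hα => Nir.hFull_eq_nirMain hα, fun α hα => ⟨Nir.hFull_neg hα, Nir.h_neg hα⟩,
    fun A _ _ d D hd a => Nir.add_pow_eq_sum_evalS hd a, fun k α q => Nir.evalS_euler_mono _ _ _ _,
    fun α hα => Nir.hasSum_integ_evalS_reflect_h hα, γ, hdeg, ?_, fun α hα => ?_,
    fun α hα n hn => ?_⟩
  · have h1 := hval 0 1 one_ne_zero
    rw [Nir.gammaVal_zero one_ne_zero, Polynomial.eq_C_of_degree_le_zero (hdeg 0).le,
      Polynomial.aeval_C, map_eq_one_iff _ (algebraMap ℚ ℂ).injective] at h1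
    rw [Polynomial.eq_C_of_degree_le_zero (hdeg 0).le, h1, Polynomial.C_1]
  · simp only [hval _ α hα]
    exact Nir.hasSum_gammaVal_mono hα
  · simp only [hval _ α hα]
    exact Nir.gammaVal_recursion hα hn
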